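/- Let $n\ge 1$ and $q\ge 2$ be integers. For $0\le i,j\le n$ put $v_i=(q-1)^i\binom{n}{i}$ and let \[K_j(i)=\sum_{l=0}^{j}(-1)^l(q-1)^{j-l}\binom{i}{l}\binom{n-i}{j-l}\] be the $q$-Krawtchouk polynomials. Choose $i\in\{0,\dots,n\}$ according to the Plancherel distribution of the Hamming scheme $H(n,q)$, that is, with probability $v_i/q^n$, and let $W=W(i)=K_1(i)/\sqrt{v_1}$ (in distribution, a binomial random variable with parameters $n$ and $1/q$ normalized to mean $0$ and variance $1$). Consider the walk on $n$-tuples over an alphabet of $q$ letters which at each step chooses a coordinate uniformly at random and replaces its value by one of the other $q-1$ values, chosen uniformly at random; for a fixed starting tuple $X_0$ let $p_2(j)$ be the probability that after two steps the tuple $X_2$ differs from $X_0$ in exactly $j$ coordinates (this does not depend on $X_0$). Let $T$ be a random variable on $\{0,\dots,n\}$ with $\mathbb P(T=t)=b_t$, where $b_t\ge 0$, $\sum_{t=0}^n b_t=1$ and $b_0\ne 1$, and put \[a=1-\sum_{t=0}^n b_t\frac{K_1(t)}{v_1}.\] Then for all real $x_0$, \begin{align*} \left|\mathbb P(W<x_0)-\frac1{\sqrt{2\pi}}\int_{-\infty}^{x_0}e^{-x^2/2}\,dx\right|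 &\le \frac{v_1}{a}\sqrt{\sum_{j=1}^n\frac{p_2(j)^2}{v_j}\left(\frac{\sum_{t=0}^n b_tK_j(t)}{v_j}+1-\frac{2\sum_{t=0}^n b_tK_1(t)}{v_1}\right)^2}\\ &\quad+\frac{\sqrt{v_1}}{\pi^{1/4}}\left[\sum_{j=0}^n\left(8-\frac6a\left(1-\frac{\sum_{t=0}^n b_tK_j(t)}{v_j}\right)\right)\frac{p_2(j)^2}{v_j}\right]^{1/4}. \end{align*} -/

import Mathlib

open MeasureTheory

/-- The number `v_i = (q - 1)^i * (n choose i)` of vertices of the Hamming graph `H(n, q)` that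
differ from a fixed vertex in exactly `i` coordinates. -/
noncomputable def hammingValency (n q i : ℕ) : ℝ :=
  ((q : ℝ) - 1) ^ i * (n.choose i : ℝ)

/-- The `q`-Krawtchouk polynomial `K_j(i)` for `0 ≤ i ≤ n`, namely
`∑_{l=0}^{j} (-1)^l (q-1)^(j-l) (i choose l) (n-i choose j-l)`. -/
noncomputable def krawtchouk (n q j i : ℕ) : ℝ :=
  ∑ l ∈ Finset.range (j + 1),
    (-1 : ℝ) ^ l * ((q : ℝ) - 1) ^ (j - l) * (i.choose l : ℝ) * ((n - i).choose (j - l) : ℝ)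

/-- The Plancherel distribution of the Hamming scheme: the measure on `{0, …, n}` that gives
the point `i` the mass `v_i / |X|`, where `|X| = q ^ n`. -/
noncomputable def hammingPlancherel (n q : ℕ) : Measure (Fin (n + 1)) :=
  ∑ i : Fin (n + 1),
    ENNReal.ofReal (hammingValency n q i / (q : ℝ) ^ n) • Measure.dirac i

/-- For `q ≥ 1` the Plancherel distribution is a probability measure. -/
theorem isProbabilityMeasure_hammingPlancherel (n q : ℕ) (hq : 1 ≤ q) :
    IsProbabilityMeasure (hammingPlancherel n q) := by
  have hq1 : (0 : ℝ) ≤ (q : ℝ) - 1 := by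
    have : (1 : ℝ) ≤ q := by exact_mod_cast hq
    linarith
  have hq0 : (0 : ℝ) < (q : ℝ) := by exact_mod_cast hq
  constructor
  have h : ∑ i : Fin (n + 1), hammingValency n q i / (q : ℝ) ^ n = 1 := by
    rw [← Finset.sum_div, div_eq_one_iff_eq (by positivity),
      Fin.sum_univ_eq_sum_range (fun i => hammingValency n q i) (n + 1)]
    have := add_pow ((q : ℝ) - 1) 1 n
    simp only [sub_add_cancel, one_pow, mul_one] at this
    exact this.symm
  simp only [hammingPlancherel, Measure.coe_finsetSum, Finset.sum_apply, Measure.smul_apply,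
    measure_univ, smul_eq_mul, mul_one]
  rw [← ENNReal.ofReal_sum_of_nonneg, h, ENNReal.ofReal_one]
  intro i _
  unfold hammingValency
  positivity

/-- The random variable `W(i) = K_1(i) / √v_1`. -/
noncomputable def hammingW (n q : ℕ) (i : Fin (n + 1)) : ℝ :=
  krawtchouk n q 1 i / Real.sqrt (hammingValency n q 1)

/-- The probability that one step of the walk on `n`-tuples over `q` letters moves from `x`
to `y`: a coordinate `k` is chosen uniformly at random, and its value is replaced by one of the
`q - 1` other values, again chosen uniformly at random. -/
noncomputable def hammingStep (n q : ℕ) (x y : Fin n → Fin q) : ℝ :=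
  ∑ k : Fin n, (1 / (n : ℝ)) *
    ∑ c ∈ Finset.univ.filter (fun c : Fin q => c ≠ x k),
      (1 / ((q : ℝ) - 1)) * (if Function.update x k c = y then 1 else 0)

/-- `p_2(j)`: the probability that, after two steps `X₀ → X₁ → X₂` of the walk started at `X₀`,
the tuple `X₂` differs from `X₀` in exactly `j` coordinates. -/
noncomputable def hammingP2 (n q : ℕ) (X₀ : Fin n → Fin q) (j : ℕ) : ℝ :=
  ∑ X₁ : Fin n → Fin q, ∑ X₂ : Fin n → Fin q,
    hammingStep n q X₀ X₁ * hammingStep n q X₁ X₂ *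
      (if hammingDist X₂ X₀ = j then 1 else 0)

/-! The proof is Stein's method for an exchangeable pair. The Plancherel law is that of the distance
from `X₀` to a uniform tuple `x`, so `W` becomes a function of `x`. Given `x`, let `y` be uniform
among the tuples at distance `T` from `x`; the pair `(x, y)` is exchangeable.

The functions `K_j(d(X₀, ·))` are orthogonal and are common eigenfunctions of all distance matrices
(`sum_krawtchouk_hammingDist`, `sum_krawtchouk_mul_krawtchouk`). Averaging over `y` therefore
multiplies them by `λ_j = ∑ b_t K_j(t) / v_j`. For `j = 1` this is the regression property `E[W(y) -
W(x) | x] = -a W(x)`, with `a = 1 - λ_1`. Moreover `W² = v_1 ∑ (p_2(j) / v_j) K_j`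
(`krawtchouk_one_sq`), so Parseval's identity yields the second and fourth moments of the increment
`Δ = W(y) - W(x)` and the mean square of `1 - E[Δ² | x] / (2a)`.

The analytic half (`stein_exchangeable_pair`) bounds the error by `2 √E(1 - E[Δ² | x] / (2a))² +
(2π)^(-1/4) √(E|Δ|³ / a)`. It tests against piecewise linear cutoffs of slope `-1/δ` and optimizes
`δ`; the constants depend on `|f'| ≤ 2` and on the Lipschitz constant `2/δ` of `f'` for the Stein
solution `f` (`exists_stein_solution`). Finally `E|Δ|³ ≤ √(E Δ² · E Δ⁴)`, with `E Δ² = 2a` and `E Δ⁴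
= v_1² a S`, where `S` is the bracket in the theorem. -/

/-! ### Krawtchouk polynomials: generating function and special values. -/

open Polynomial in
theorem coeff_one_add_C_mul_X_pow (r : ℝ) (m k : ℕ) :
    ((1 + C r * X : ℝ[X]) ^ m).coeff k = r ^ k * (m.choose k : ℝ) := by
  have h : (1 + C r * X : ℝ[X]) ^ m = ((1 + X) ^ m : ℝ[X]).comp (C r * X) := by simp
  rw [h, comp_C_mul_X_coeff, coeff_one_add_X_pow, mul_comm]

open Polynomial in
/-- The generating function of the Krawtchouk polynomials. -/
theorem krawtchouk_eq_coeff (n q j s : ℕ) :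
    krawtchouk n q j s
      = ((1 - X : ℝ[X]) ^ s * (1 + C ((q : ℝ) - 1) * X) ^ (n - s)).coeff j := by
  have h : (1 - X : ℝ[X]) = 1 + C (-1) * X := by simp [sub_eq_add_neg]
  rw [h, coeff_mul, Finset.Nat.sum_antidiagonal_eq_sum_range_succ_mk, krawtchouk]
  refine Finset.sum_congr rfl fun l _ => ?_
  rw [coeff_one_add_C_mul_X_pow, coeff_one_add_C_mul_X_pow]
  ring

theorem krawtchouk_zero_left (n q i : ℕ) : krawtchouk n q 0 i = 1 := by
  simp [krawtchouk]

theorem krawtchouk_zero_right (n q j : ℕ) : krawtchouk n q j 0 = hammingValency n q j := by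
  rw [krawtchouk, Finset.sum_range_succ', Finset.sum_eq_zero]
  · simp [hammingValency]
  · intro l _
    simp

theorem krawtchouk_one_left (n q i : ℕ) (hi : i ≤ n) :
    krawtchouk n q 1 i = ((q : ℝ) - 1) * n - q * i := by
  simp [krawtchouk, Finset.sum_range_succ, Nat.cast_sub hi]
  ring

theorem hammingValency_pos (n q j : ℕ) (hq : 2 ≤ q) (hj : j ≤ n) : 0 < hammingValency n q j := by
  have h1 : (2 : ℝ) ≤ q := by exact_mod_cast hq
  have h2 : (0 : ℝ) < n.choose j := by exact_mod_cast Nat.choose_pos hj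
  exact mul_pos (pow_pos (by linarith) _) h2

theorem hammingDist_le (n q : ℕ) (x y : Fin n → Fin q) : hammingDist x y ≤ n := by
  simpa using hammingDist_le_card_fintype (x := x) (y := y)

/-! ### Krawtchouk functions on tuples: eigenfunctions and orthogonality. -/

/-- The function `q 1_{s = c} - 1` on the alphabet. -/
noncomputable def letterChar (q : ℕ) (c s : Fin q) : ℝ := if s = c then (q : ℝ) - 1 else -1

theorem sum_letterChar (q : ℕ) (c : Fin q) : ∑ s, letterChar q c s = 0 := by
  have h : ∀ s, letterChar q c s = (if s = c then (q : ℝ) else 0) - 1 := by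
    intro s; unfold letterChar; split_ifs <;> ring
  simp [h]

theorem sum_letterChar_sq (q : ℕ) (c : Fin q) :
    ∑ s, letterChar q c s * letterChar q c s = q * ((q : ℝ) - 1) := by
  have h : ∀ s, letterChar q c s * letterChar q c s
      = (if s = c then (q : ℝ) * (q - 2) else 0) + 1 := by
    intro s; unfold letterChar; split_ifs <;> ring
  simp [h, Finset.sum_add_distrib]
  ring

-- In the generating function, a coordinate where the tuples differ contributes `1 - X` and one
-- where they agree contributes `1 + (q - 1) X`; both are `1 + χ X` with `χ` the value of
-- `letterChar`. Hence `K_j` is the `j`-th elementary symmetric polynomial in these values.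
open Polynomial in
theorem krawtchouk_hammingDist (n q j : ℕ) (X₀ x : Fin n → Fin q) :
    krawtchouk n q j (hammingDist X₀ x)
      = ∑ S ∈ Finset.powersetCard j Finset.univ, ∏ k ∈ S, letterChar q (X₀ k) (x k) := by
  have h : ((1 - X : ℝ[X]) ^ hammingDist X₀ x
        * (1 + C ((q : ℝ) - 1) * X) ^ (n - hammingDist X₀ x))
      = ∏ k, (1 + C (letterChar q (X₀ k) (x k)) * X) := by
    have h1 : ∀ k, (1 + C (letterChar q (X₀ k) (x k)) * X : ℝ[X])
        = if X₀ k ≠ x k then 1 - X else 1 + C ((q : ℝ) - 1) * X := by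
      intro k
      unfold letterChar
      by_cases hk : x k = X₀ k
      · simp [hk]
      · simp [hk, Ne.symm hk, sub_eq_add_neg]
    simp_rw [h1]
    rw [Finset.prod_ite, Finset.prod_const, Finset.prod_const]
    congr 2
    have := Finset.card_filter_add_card_filter_not (s := Finset.univ) (fun k => X₀ k ≠ x k)
    simp only [Finset.card_univ, Fintype.card_fin] at this
    unfold hammingDist
    omega
  rw [krawtchouk_eq_coeff, h, Finset.prod_one_add, finsetSum_coeff, Finset.powersetCard_eq_filter,
    Finset.sum_filter]
  refine Finset.sum_congr rfl fun S _ => ?_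
  rw [Finset.prod_mul_distrib, Finset.prod_const, ← map_prod, coeff_C_mul, coeff_X_pow]
  simp [eq_comm]

-- The generating function in `t` factors over the coordinates. Since `letterChar` has sum zero, a
-- coordinate in `S` gives `χ (1 - X)`; any other gives `1 + (q - 1) X`. The eigenvalue depends only
-- on the size of `S`, so it is shared by all the products that make up one `K_j`.
open Polynomial in
theorem sum_prod_letterChar_hammingDist (n q t : ℕ) (X₀ x : Fin n → Fin q) (S : Finset (Fin n)) :
    ∑ y : Fin n → Fin q,
        (if hammingDist x y = t then ∏ k ∈ S, letterChar q (X₀ k) (y k) else 0)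
      = krawtchouk n q t S.card * ∏ k ∈ S, letterChar q (X₀ k) (x k) := by
  let F : Fin n → Fin q → ℝ[X] := fun k s =>
    (if x k ≠ s then X else 1) * (if k ∈ S then C (letterChar q (X₀ k) s) else 1)
  have h1 : ∀ y : Fin n → Fin q, ∏ k, F k (y k)
      = C (∏ k ∈ S, letterChar q (X₀ k) (y k)) * X ^ hammingDist x y := by
    intro y
    simp only [F]
    rw [Finset.prod_mul_distrib, Finset.prod_ite, Finset.prod_const, Finset.prod_const_one,
      mul_one, Finset.prod_ite_mem, Finset.univ_inter, mul_comm, ← map_prod]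
    rfl
  have h2 : ∀ k, ∑ s, F k s = if k ∈ S then C (letterChar q (X₀ k) (x k)) * (1 - X)
      else 1 + C ((q : ℝ) - 1) * X := by
    intro k
    simp only [F]
    split_ifs with hk
    · have : ∀ s, (if x k ≠ s then (X : ℝ[X]) else 1) * C (letterChar q (X₀ k) s)
          = C (letterChar q (X₀ k) s) * X
            + (if x k = s then C (letterChar q (X₀ k) s) * (1 - X) else 0) := by
        intro s
        by_cases h : x k = s
        · simp [h]; ring
        · simp [h]
      simp_rw [this, Finset.sum_add_distrib, ← Finset.sum_mul, ← map_sum, sum_letterChar]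
      simp
    · have : ∀ s, (if x k ≠ s then (X : ℝ[X]) else 1) * 1
          = X + (if x k = s then 1 - X else 0) := by
        intro s
        by_cases h : x k = s <;> simp [h]
      simp_rw [this, Finset.sum_add_distrib]
      simp
      ring
  have h3 := Finset.prod_univ_sum (fun _ : Fin n => (Finset.univ : Finset (Fin q))) F
  rw [Fintype.piFinset_univ] at h3
  simp_rw [h1, h2] at h3
  have h4 := congrArg (fun p => coeff p t) h3
  simp only [finsetSum_coeff, coeff_C_mul, coeff_X_pow] at h4
  have h5 : ∏ k, (if k ∈ S then C (letterChar q (X₀ k) (x k)) * (1 - X)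
      else 1 + C ((q : ℝ) - 1) * X : ℝ[X])
      = C (∏ k ∈ S, letterChar q (X₀ k) (x k))
        * ((1 - X) ^ S.card * (1 + C ((q : ℝ) - 1) * X) ^ (n - S.card)) := by
    rw [Finset.prod_ite, Finset.prod_mul_distrib, Finset.prod_const, Finset.prod_const, ← map_prod,
      Finset.filter_mem_eq_inter, Finset.univ_inter, Finset.filter_notMem_eq_sdiff,
      Finset.card_sdiff, mul_assoc]
    simp
  rw [h5, coeff_C_mul, ← krawtchouk_eq_coeff] at h4
  rw [mul_comm, h4]
  refine Finset.sum_congr rfl fun y _ => ?_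
  simp [eq_comm]

/-- The Krawtchouk functions are eigenfunctions of the distance matrices. -/
theorem sum_krawtchouk_hammingDist (n q j t : ℕ) (X₀ x : Fin n → Fin q) :
    ∑ y : Fin n → Fin q,
        (if hammingDist x y = t then krawtchouk n q j (hammingDist X₀ y) else 0)
      = krawtchouk n q t j * krawtchouk n q j (hammingDist X₀ x) := by
  simp_rw [krawtchouk_hammingDist n q j]
  have h : ∀ y : Fin n → Fin q, (if hammingDist x y = t then
        ∑ S ∈ Finset.powersetCard j Finset.univ, ∏ k ∈ S, letterChar q (X₀ k) (y k) else 0)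
      = ∑ S ∈ Finset.powersetCard j Finset.univ,
        (if hammingDist x y = t then ∏ k ∈ S, letterChar q (X₀ k) (y k) else 0) := by
    intro y; split_ifs <;> simp
  simp_rw [h]
  rw [Finset.sum_comm, Finset.mul_sum]
  refine Finset.sum_congr rfl fun S hS => ?_
  rw [sum_prod_letterChar_hammingDist, (Finset.mem_powersetCard.mp hS).2]

theorem card_hammingDist_eq (n q t : ℕ) (x : Fin n → Fin q) :
    ∑ y : Fin n → Fin q, (if hammingDist x y = t then (1 : ℝ) else 0) = hammingValency n q t := by
  have h := sum_krawtchouk_hammingDist n q 0 t x x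
  simpa [krawtchouk_zero_left, krawtchouk_zero_right, hammingValency] using h

/-- The eigenvalue identity is evaluated at the base point itself, where the sum over the sphere of
radius `t` is `v_t K_j(t)`. -/
theorem krawtchouk_symm (n q j t : ℕ) (x : Fin n → Fin q) :
    hammingValency n q j * krawtchouk n q t j = hammingValency n q t * krawtchouk n q j t := by
  have h := sum_krawtchouk_hammingDist n q j t x x
  rw [hammingDist_self, krawtchouk_zero_right] at h
  rw [mul_comm, ← h, ← card_hammingDist_eq n q t x, Finset.sum_mul]
  refine Finset.sum_congr rfl fun y _ => ?_
  split_ifs with hy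
  · rw [hy, one_mul]
  · simp

/-- The sum factors over coordinates: one in both sets gives `q (q - 1)`, one in neither gives `q`,
and one in exactly one set gives zero. -/
theorem sum_prod_letterChar_mul (n q : ℕ) (X₀ : Fin n → Fin q) (S T : Finset (Fin n)) :
    ∑ x : Fin n → Fin q,
        (∏ k ∈ S, letterChar q (X₀ k) (x k)) * (∏ k ∈ T, letterChar q (X₀ k) (x k))
      = if S = T then (q : ℝ) ^ n * ((q : ℝ) - 1) ^ S.card else 0 := by
  let F : Fin n → Fin q → ℝ := fun k s =>
    (if k ∈ S then letterChar q (X₀ k) s else 1) * (if k ∈ T then letterChar q (X₀ k) s else 1)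
  have h3 := Finset.prod_univ_sum (fun _ : Fin n => (Finset.univ : Finset (Fin q))) F
  rw [Fintype.piFinset_univ] at h3
  have h1 : ∀ x : Fin n → Fin q, ∏ k, F k (x k)
      = (∏ k ∈ S, letterChar q (X₀ k) (x k)) * (∏ k ∈ T, letterChar q (X₀ k) (x k)) := by
    intro x
    simp only [F]
    rw [Finset.prod_mul_distrib, Finset.prod_ite_mem, Finset.prod_ite_mem, Finset.univ_inter,
      Finset.univ_inter]
  simp_rw [h1] at h3
  rw [← h3]
  split_ifs with h
  · subst h
    have h2 : ∀ k, ∑ s, F k s = q * (if k ∈ S then (q : ℝ) - 1 else 1) := by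
      intro k
      by_cases hk : k ∈ S
      · simp [F, hk, sum_letterChar_sq]
      · simp [F, hk]
    simp_rw [h2, Finset.prod_mul_distrib]
    simp
  · obtain ⟨k, hk⟩ : ∃ k, ¬ (k ∈ S ↔ k ∈ T) := by
      by_contra! hc
      exact h (Finset.ext hc)
    refine Finset.prod_eq_zero (Finset.mem_univ k) ?_
    by_cases hS : k ∈ S
    · have hT : k ∉ T := by tauto
      simp [F, hS, hT, sum_letterChar]
    · have hT : k ∈ T := by tauto
      simp [F, hS, hT, sum_letterChar]

/-- Orthogonality of the Krawtchouk functions. -/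
theorem sum_krawtchouk_mul_krawtchouk (n q i j : ℕ) (X₀ : Fin n → Fin q) :
    ∑ x : Fin n → Fin q,
        krawtchouk n q i (hammingDist X₀ x) * krawtchouk n q j (hammingDist X₀ x)
      = if i = j then (q : ℝ) ^ n * hammingValency n q i else 0 := by
  simp_rw [krawtchouk_hammingDist, Finset.sum_mul_sum]
  rw [Finset.sum_comm]
  have : ∀ S ∈ Finset.powersetCard i (Finset.univ : Finset (Fin n)),
      ∑ x : Fin n → Fin q, ∑ T ∈ Finset.powersetCard j Finset.univ,
        (∏ k ∈ S, letterChar q (X₀ k) (x k)) * (∏ k ∈ T, letterChar q (X₀ k) (x k))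
      = if i = j then (q : ℝ) ^ n * ((q : ℝ) - 1) ^ i else 0 := by
    intro S hS
    rw [Finset.sum_comm]
    simp_rw [sum_prod_letterChar_mul]
    rw [Finset.sum_ite_eq]
    simp only [Finset.mem_powersetCard, Finset.subset_univ, true_and] at hS ⊢
    rw [hS]
  rw [Finset.sum_congr rfl this, Finset.sum_const, Finset.card_powersetCard]
  split_ifs <;> simp [hammingValency]
  ring

/-! ### The two-step walk and the expansion of the square of `K_1`. -/

theorem hammingStep_eq (n q : ℕ) (x y : Fin n → Fin q) :
    hammingStep n q x y = if hammingDist x y = 1 then 1 / hammingValency n q 1 else 0 := by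
  have h1 : ∀ k, ∑ c ∈ Finset.univ.filter (fun c : Fin q => c ≠ x k),
      (1 / ((q : ℝ) - 1)) * (if Function.update x k c = y then 1 else 0)
      = if Finset.univ.filter (fun k => x k ≠ y k) = {k} then 1 / ((q : ℝ) - 1) else 0 := by
    intro k
    have h2 : ∀ c, c ≠ x k → (Function.update x k c = y ↔
        (Finset.univ.filter (fun k => x k ≠ y k) = {k} ∧ c = y k)) := by
      intro c hc
      constructor
      · rintro rfl
        refine ⟨?_, by simp⟩
        ext i
        by_cases hi : i = k
        · subst hi; simp [hc.symm]
        · simp [hi]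
      · rintro ⟨h, rfl⟩
        ext i
        by_cases hi : i = k
        · subst hi; simp
        · have : i ∉ Finset.univ.filter (fun k => x k ≠ y k) := by simp [h, hi]
          simp only [Finset.mem_filter, Finset.mem_univ, true_and, not_not] at this
          simp [hi, this]
    rw [Finset.sum_congr rfl (g := fun c => if c = y k then
      (if Finset.univ.filter (fun k => x k ≠ y k) = {k} then 1 / ((q : ℝ) - 1) else 0) else 0)]
    · rw [Finset.sum_ite_eq']
      split_ifs with ha hb hb
      · rfl
      · rfl
      · have : k ∈ Finset.univ.filter (fun k => x k ≠ y k) := by simp [hb]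
        simp only [Finset.mem_filter, Finset.mem_univ, true_and] at this ha
        exact absurd (Ne.symm this) ha
      · rfl
    · intro c hc
      simp only [Finset.mem_filter, Finset.mem_univ, true_and] at hc
      simp only [h2 c hc]
      by_cases ha : c = y k <;> simp [ha]
  simp only [hammingStep, h1]
  split_ifs with h
  · obtain ⟨k₀, hk⟩ := Finset.card_eq_one.mp h
    have h3 : ∀ k, ({k₀} : Finset (Fin n)) = {k} ↔ k = k₀ := fun k => by
      rw [Finset.singleton_inj, eq_comm]
    simp [hk, h3, hammingValency]
  · refine Finset.sum_eq_zero fun k _ => ?_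
    rw [if_neg, mul_zero]
    intro hk
    exact h (by rw [hammingDist, hk, Finset.card_singleton])

theorem sum_hammingStep_krawtchouk (n q j : ℕ) (X₀ x : Fin n → Fin q) :
    ∑ y, hammingStep n q x y * krawtchouk n q j (hammingDist X₀ y)
      = krawtchouk n q 1 j / hammingValency n q 1 * krawtchouk n q j (hammingDist X₀ x) := by
  have h := sum_krawtchouk_hammingDist n q j 1 X₀ x
  rw [div_mul_eq_mul_div, ← h, Finset.sum_div]
  refine Finset.sum_congr rfl fun y _ => ?_
  rw [hammingStep_eq]
  split_ifs <;> ring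

/-- Both steps of the walk multiply `K_m` by the eigenvalue `K_1(m) / v_1`, and the walk starts at
distance zero, where `K_m(0) = v_m`. -/
theorem sum_hammingP2_krawtchouk (n q m : ℕ) (X₀ : Fin n → Fin q) :
    ∑ j ∈ Finset.range (n + 1), hammingP2 n q X₀ j * krawtchouk n q m j
      = (krawtchouk n q 1 m / hammingValency n q 1) ^ 2 * hammingValency n q m := by
  have h : ∀ X₁ X₂ : Fin n → Fin q, ∑ j ∈ Finset.range (n + 1),
      hammingStep n q X₀ X₁ * hammingStep n q X₁ X₂ * (if hammingDist X₂ X₀ = j then 1 else 0)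
        * krawtchouk n q m j
      = hammingStep n q X₀ X₁
        * (hammingStep n q X₁ X₂ * krawtchouk n q m (hammingDist X₀ X₂)) := by
    intro X₁ X₂
    rw [Finset.sum_eq_single (hammingDist X₂ X₀)]
    · simp [hammingDist_comm X₀ X₂]; ring
    · intro j _ hj; simp [hj.symm]
    · intro hj
      exact absurd (Finset.mem_range.mpr (Nat.lt_succ_of_le (hammingDist_le n q X₂ X₀))) hj
  simp_rw [hammingP2, Finset.sum_mul]
  rw [Finset.sum_comm]
  simp_rw [fun X₁ => Finset.sum_comm (s := Finset.range (n + 1))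
    (t := (Finset.univ : Finset (Fin n → Fin q))) (f := fun j X₂ =>
      hammingStep n q X₀ X₁ * hammingStep n q X₁ X₂ * (if hammingDist X₂ X₀ = j then 1 else 0)
        * krawtchouk n q m j), h, ← Finset.mul_sum, sum_hammingStep_krawtchouk]
  have h2 := sum_hammingStep_krawtchouk n q m X₀ X₀
  rw [hammingDist_self, krawtchouk_zero_right] at h2
  simp_rw [mul_left_comm (hammingStep n q X₀ _), ← Finset.mul_sum, h2]
  ring

/-- The linearization of the square of `K_1`. -/
theorem krawtchouk_one_sq (n q m : ℕ) (hq : 2 ≤ q) (hm : m ≤ n) (X₀ : Fin n → Fin q) :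
    (krawtchouk n q 1 m / hammingValency n q 1) ^ 2
      = ∑ j ∈ Finset.range (n + 1),
          hammingP2 n q X₀ j / hammingValency n q j * krawtchouk n q j m := by
  have hv := (hammingValency_pos n q m hq hm).ne'
  refine mul_right_cancel₀ hv ?_
  rw [← sum_hammingP2_krawtchouk n q m X₀, Finset.sum_mul]
  refine Finset.sum_congr rfl fun j hj => ?_
  have hj := (hammingValency_pos n q j hq (Nat.lt_succ_iff.mp (Finset.mem_range.mp hj))).ne'
  have := krawtchouk_symm n q m j X₀
  field_simp
  linear_combination -hammingP2 n q X₀ j * this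

/-! ### Calculus of the Gaussian weight. -/

theorem hasDerivAt_exp_neg_sq_half (x : ℝ) :
    HasDerivAt (fun x : ℝ => Real.exp (-x ^ 2 / 2)) (-x * Real.exp (-x ^ 2 / 2)) x := by
  have h : HasDerivAt (fun x : ℝ => -x ^ 2 / 2) (-x) x := by
    refine ((hasDerivAt_pow 2 x).neg.div_const 2).congr_deriv ?_
    push_cast
    ring
  refine h.exp.congr_deriv ?_
  ring

theorem continuous_exp_neg_sq_half : Continuous fun x : ℝ => Real.exp (-x ^ 2 / 2) := by
  fun_prop

theorem integrable_exp_neg_sq_half : Integrable fun x : ℝ => Real.exp (-x ^ 2 / 2) := by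
  have := integrable_exp_neg_mul_sq (b := 1 / 2) (by norm_num)
  convert this using 3
  ring

theorem integrable_mul_exp_neg_sq_half :
    Integrable fun x : ℝ => x * Real.exp (-x ^ 2 / 2) := by
  have := integrable_mul_exp_neg_mul_sq (b := 1 / 2) (by norm_num)
  convert this using 4
  ring

theorem integral_exp_neg_sq_half : ∫ x : ℝ, Real.exp (-x ^ 2 / 2) = √(2 * Real.pi) := by
  have := integral_gaussian (1 / 2)
  rw [show Real.pi / (1 / 2) = 2 * Real.pi by ring] at this
  rw [← this]
  congr 1
  ext x
  congr 1
  ring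

theorem tendsto_exp_neg_sq_half_atTop :
    Filter.Tendsto (fun x : ℝ => Real.exp (-x ^ 2 / 2)) Filter.atTop (nhds 0) := by
  refine Real.tendsto_exp_atBot.comp ?_
  have : Filter.Tendsto (fun x : ℝ => -(x ^ 2 / 2)) Filter.atTop Filter.atBot :=
    Filter.tendsto_neg_atTop_atBot.comp
      ((Filter.tendsto_pow_atTop two_ne_zero).atTop_div_const two_pos)
  simpa [neg_div] using this

theorem tendsto_exp_neg_sq_half_atBot :
    Filter.Tendsto (fun x : ℝ => Real.exp (-x ^ 2 / 2)) Filter.atBot (nhds 0) := by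
  have := tendsto_exp_neg_sq_half_atTop.comp Filter.tendsto_neg_atBot_atTop
  refine this.congr fun x => ?_
  simp

theorem integral_Iic_mul_exp_neg_sq_half (w : ℝ) :
    ∫ x in Set.Iic w, x * Real.exp (-x ^ 2 / 2) = -Real.exp (-w ^ 2 / 2) := by
  have h := integral_Iic_of_hasDerivAt_of_tendsto' (a := w) (m := 0)
    (f := fun x : ℝ => -Real.exp (-x ^ 2 / 2)) (f' := fun x => x * Real.exp (-x ^ 2 / 2))
    (fun x _ => (hasDerivAt_exp_neg_sq_half x).neg.congr_deriv (by ring)) integrable_mul_exp_neg_sq_half.integrableOn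
    (by simpa using tendsto_exp_neg_sq_half_atBot.neg)
  simpa using h

/-! ### Bounds for solutions of Stein's equation. -/

/-- The product of a solution of `u' = x u + r` with the Gaussian weight. -/
theorem hasDerivWithinAt_mul_exp_neg_sq_half {u : ℝ → ℝ} {r x : ℝ}
    (hu : HasDerivWithinAt u (x * u x + r) (Set.Ici x) x) :
    HasDerivWithinAt (fun x => u x * Real.exp (-x ^ 2 / 2)) (r * Real.exp (-x ^ 2 / 2))
      (Set.Ici x) x := by
  refine (hu.mul (hasDerivAt_exp_neg_sq_half x).hasDerivWithinAt).congr_deriv ?_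
  ring

/-- With `e` the Gaussian weight, `(u - C / w) e` is nondecreasing on `[w, ∞)`, because `(u e)' = r
e ≥ -C e ≥ -(C / w) x e` there. Being at most a constant times `e`, which tends to zero, it is
nonpositive at `w`. Right derivatives suffice, as needed when the test function has corners. -/
theorem mul_le_of_hasDerivWithinAt_of_pos {u r : ℝ → ℝ} {M C w : ℝ} (hc : Continuous u)
    (hu : ∀ x, HasDerivWithinAt u (x * u x + r x) (Set.Ici x) x) (hM : ∀ x, u x ≤ M)
    (hC0 : 0 ≤ C) (hC : ∀ x, -C ≤ r x) (hw : 0 < w) : w * u w ≤ C := by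
  have key : ∀ b, w < b →
      (u w - C / w) * Real.exp (-w ^ 2 / 2) ≤ (M - C / w) * Real.exp (-b ^ 2 / 2) := by
    intro b hb
    have h := image_le_of_deriv_right_le_deriv_boundary (a := w) (b := b)
      (f := fun x => C / w * Real.exp (-x ^ 2 / 2)
        + (u w - C / w) * Real.exp (-w ^ 2 / 2))
      (f' := fun x => C / w * (-x * Real.exp (-x ^ 2 / 2)))
      (B := fun x => u x * Real.exp (-x ^ 2 / 2)) (B' := fun x => r x * Real.exp (-x ^ 2 / 2))
      (by fun_prop)
      (fun x _ => (((hasDerivAt_exp_neg_sq_half x).const_mul (C / w)).add_const _).hasDerivWithinAt)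
      (by linarith) (by fun_prop)
      (fun x _ => hasDerivWithinAt_mul_exp_neg_sq_half (hu x))
      (by
        intro x hx
        have h1 : C ≤ C / w * x := by
          rw [div_mul_eq_mul_div, le_div_iff₀ hw]
          exact mul_le_mul_of_nonneg_left hx.1 hC0
        have h2 := hC x
        have h3 := Real.exp_pos (-x ^ 2 / 2)
        nlinarith)
      (Set.right_mem_Icc.mpr hb.le)
    have h4 := mul_le_mul_of_nonneg_right (hM b) (Real.exp_pos (-b ^ 2 / 2)).le
    linarith
  have hlim : Filter.Tendsto (fun b : ℝ => (M - C / w) * Real.exp (-b ^ 2 / 2)) Filter.atTop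
      (nhds 0) := by
    simpa using tendsto_exp_neg_sq_half_atTop.const_mul (M - C / w)
  have h0 := ge_of_tendsto hlim ((Filter.eventually_gt_atTop w).mono key)
  have h1 : u w ≤ C / w := by
    by_contra! hcon
    exact absurd h0 (not_le.mpr (mul_pos (sub_pos.mpr hcon) (Real.exp_pos _)))
  rw [le_div_iff₀ hw] at h1
  linarith

/-- The same comparison, run towards `-∞`. A reflection of the positive case would turn right
derivatives into left ones. -/
theorem neg_mul_le_of_hasDerivWithinAt_of_neg {u r : ℝ → ℝ} {M C w : ℝ} (hc : Continuous u)
    (hu : ∀ x, HasDerivWithinAt u (x * u x + r x) (Set.Ici x) x) (hM : ∀ x, u x ≤ M)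
    (hC0 : 0 ≤ C) (hC : ∀ x, r x ≤ C) (hw : w < 0) : -w * u w ≤ C := by
  have hw' : 0 < -w := neg_pos.mpr hw
  have key : ∀ b, b < w →
      (u w - C / -w) * Real.exp (-w ^ 2 / 2) ≤ (M - C / -w) * Real.exp (-b ^ 2 / 2) := by
    intro b hb
    have h := image_le_of_deriv_right_le_deriv_boundary (a := b) (b := w)
      (B := fun x => C / -w * Real.exp (-x ^ 2 / 2)
        + (u b - C / -w) * Real.exp (-b ^ 2 / 2))
      (B' := fun x => C / -w * (-x * Real.exp (-x ^ 2 / 2)))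
      (f := fun x => u x * Real.exp (-x ^ 2 / 2)) (f' := fun x => r x * Real.exp (-x ^ 2 / 2))
      (by fun_prop)
      (fun x _ => hasDerivWithinAt_mul_exp_neg_sq_half (hu x))
      (by linarith) (by fun_prop)
      (fun x _ => (((hasDerivAt_exp_neg_sq_half x).const_mul (C / -w)).add_const _).hasDerivWithinAt)
      (by
        intro x hx
        have h1 : C ≤ C / -w * -x := by
          rw [div_mul_eq_mul_div, le_div_iff₀ hw']
          exact mul_le_mul_of_nonneg_left (neg_le_neg hx.2.le) hC0
        have h2 := hC x
        have h3 := Real.exp_pos (-x ^ 2 / 2)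
        nlinarith)
      (Set.right_mem_Icc.mpr hb.le)
    have h4 := mul_le_mul_of_nonneg_right (hM b) (Real.exp_pos (-b ^ 2 / 2)).le
    linarith
  have hlim : Filter.Tendsto (fun b : ℝ => (M - C / -w) * Real.exp (-b ^ 2 / 2)) Filter.atBot
      (nhds 0) := by
    simpa using tendsto_exp_neg_sq_half_atBot.const_mul (M - C / -w)
  have h0 := ge_of_tendsto hlim ((Filter.eventually_lt_atBot w).mono key)
  have h1 : u w ≤ C / -w := by
    by_contra! hcon
    exact absurd h0 (not_le.mpr (mul_pos (sub_pos.mpr hcon) (Real.exp_pos _)))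
  rw [le_div_iff₀ hw'] at h1
  linarith

/-- A bounded solution of `u' = x u + r` with `|r| ≤ C` satisfies `|x u| ≤ C`. -/
theorem abs_mul_le_of_hasDerivWithinAt {u r : ℝ → ℝ} {M C : ℝ} (hc : Continuous u)
    (hu : ∀ x, HasDerivWithinAt u (x * u x + r x) (Set.Ici x) x) (hM : ∀ x, |u x| ≤ M)
    (hC : ∀ x, |r x| ≤ C) (w : ℝ) : |w * u w| ≤ C := by
  have hC0 : 0 ≤ C := (abs_nonneg _).trans (hC 0)
  have hu' : ∀ x, HasDerivWithinAt (fun x => -u x) (x * (-u x) + -r x) (Set.Ici x) x := by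
    intro x
    refine (hu x).neg.congr_deriv ?_
    ring
  have hM1 : ∀ x, u x ≤ M := fun x => (le_abs_self _).trans (hM x)
  have hM2 : ∀ x, -u x ≤ M := fun x => (neg_le_abs _).trans (hM x)
  have hC1 : ∀ x, r x ≤ C := fun x => (le_abs_self _).trans (hC x)
  have hC2 : ∀ x, -r x ≤ C := fun x => (neg_le_abs _).trans (hC x)
  rw [abs_le]
  rcases lt_trichotomy w 0 with hw | rfl | hw
  · have h1 := neg_mul_le_of_hasDerivWithinAt_of_neg hc hu hM1 hC0 hC1 hw
    have h2 := neg_mul_le_of_hasDerivWithinAt_of_neg hc.neg hu' hM2 hC0 hC2 hw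
    rw [Pi.neg_apply] at h2
    constructor <;> linarith
  · simpa using hC0
  · have h1 := mul_le_of_hasDerivWithinAt_of_pos hc hu hM1 hC0 (fun x => by linarith [hC2 x]) hw
    have h2 := mul_le_of_hasDerivWithinAt_of_pos hc.neg hu' hM2 hC0
      (fun x => by linarith [hC1 x]) hw
    rw [Pi.neg_apply] at h2
    constructor <;> linarith

/-- If `r w ≤ 0` the integrand is nonpositive up to `w`; otherwise it is nonnegative beyond `w`, and
the two parts add up to zero. -/
theorem integral_Iic_nonpos_of_monotone {r e : ℝ → ℝ} (hr : Monotone r) (he : ∀ x, 0 ≤ e x)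
    (hint : Integrable fun x => r x * e x) (h0 : ∫ x, r x * e x = 0) (w : ℝ) :
    ∫ x in Set.Iic w, r x * e x ≤ 0 := by
  rcases le_total (r w) 0 with hw | hw
  · exact setIntegral_nonpos measurableSet_Iic fun x hx =>
      mul_nonpos_of_nonpos_of_nonneg ((hr hx).trans hw) (he x)
  · have h1 := intervalIntegral.integral_Iic_add_Ioi (b := w) hint.integrableOn hint.integrableOn
    have h2 : 0 ≤ ∫ x in Set.Ioi w, r x * e x := setIntegral_nonneg measurableSet_Ioi fun x hx =>
      mul_nonneg (hw.trans (hr (le_of_lt hx))) (he x)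
    linarith

/-- Lipschitz bound from a bound on the right derivative. -/
theorem abs_sub_le_of_hasDerivWithinAt {g g' : ℝ → ℝ} {C : ℝ} (hc : Continuous g)
    (hg : ∀ x, HasDerivWithinAt g (g' x) (Set.Ici x) x) (hC : ∀ x, |g' x| ≤ C) (x y : ℝ) :
    |g x - g y| ≤ C * |x - y| := by
  have key : ∀ x y, x ≤ y → |g y - g x| ≤ C * (y - x) := fun x y hxy =>
    norm_image_sub_le_of_norm_deriv_right_le_segment (a := x) (b := y) hc.continuousOn
      (fun z _ => hg z) (fun z _ => hC z) y (Set.right_mem_Icc.mpr hxy)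
  rcases le_total x y with h | h
  · rw [abs_sub_comm, abs_of_nonpos (sub_nonpos.mpr h)]
    simpa using key x y h
  · rw [abs_of_nonneg (sub_nonneg.mpr h)]
    exact key y x h

/-- The Gaussian expectation of `h`. -/
noncomputable def gaussianMean (h : ℝ → ℝ) : ℝ :=
  1 / √(2 * Real.pi) * ∫ x, h x * Real.exp (-x ^ 2 / 2)

/-- Bounds on the solution of Stein's equation for a decreasing Lipschitz test function. -/
theorem exists_stein_solution {h h' : ℝ → ℝ} {L : ℝ} (hc : Continuous h) (h0 : ∀ x, 0 ≤ h x)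
    (h1 : ∀ x, h x ≤ 1) (hanti : Antitone h) (hmono : Monotone fun x => h x + L * x)
    (hd : ∀ x, HasDerivWithinAt h (h' x) (Set.Ici x) x) (hd0 : ∀ x, h' x ≤ 0)
    (hdL : ∀ x, -L ≤ h' x) :
    ∃ f f' : ℝ → ℝ, (∀ x, HasDerivAt f (f' x) x) ∧ (∀ x, f' x = x * f x + (h x - gaussianMean h))
      ∧ (∀ x, |f' x| ≤ 2) ∧ ∀ x y, |f' x - f' y| ≤ 2 * L * |x - y| := by
  set N := gaussianMean h with hN
  have hpi : 0 < √(2 * Real.pi) := Real.sqrt_pos.mpr (by positivity)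
  let e : ℝ → ℝ := fun x => Real.exp (-x ^ 2 / 2)
  have he : ∀ x, 0 < e x := fun x => Real.exp_pos _
  have hec : Continuous e := continuous_exp_neg_sq_half
  have hei : Integrable e := integrable_exp_neg_sq_half
  have hhe : Integrable fun x => h x * e x := by
    refine hei.mono (hc.mul hec).aestronglyMeasurable (Filter.Eventually.of_forall fun x => ?_)
    rw [norm_mul, Real.norm_of_nonneg (h0 x)]
    exact mul_le_of_le_one_left (norm_nonneg _) (h1 x)
  have hri : Integrable fun x => (h x - N) * e x := by
    simp_rw [sub_mul]
    exact hhe.sub (hei.const_mul N)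
  have hxe : Integrable fun x => x * e x := integrable_mul_exp_neg_sq_half
  have hint : ∫ x, h x * e x = N * √(2 * Real.pi) := by
    rw [hN, gaussianMean]
    change _ = 1 / √(2 * Real.pi) * (∫ x, h x * e x) * √(2 * Real.pi)
    field_simp
  have hN0 : 0 ≤ N := by
    rw [hN, gaussianMean]
    exact mul_nonneg (by positivity)
      (integral_nonneg fun x => mul_nonneg (h0 x) (Real.exp_pos _).le)
  have hN1 : N ≤ 1 := by
    have : ∫ x, h x * e x ≤ √(2 * Real.pi) := by
      rw [← integral_exp_neg_sq_half]
      exact integral_mono hhe hei fun x => mul_le_of_le_one_left (he x).le (h1 x)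
    rw [hint] at this
    nlinarith
  have hr0 : ∫ x, (h x - N) * e x = 0 := by
    simp_rw [sub_mul]
    rw [integral_sub hhe (hei.const_mul N), hint, integral_const_mul]
    have : ∫ x, e x = √(2 * Real.pi) := integral_exp_neg_sq_half
    rw [this, sub_self]
  have hxe0 : ∫ x, x * e x = 0 := by
    have h := integral_neg_eq_self (fun x => x * e x) volume
    have h2 : ∀ x, -x * e (-x) = -(x * e x) := fun x => by simp [e]
    simp_rw [h2, integral_neg] at h
    linarith
  let I : ℝ → ℝ := fun w => ∫ x in Set.Iic w, (h x - N) * e x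
  have hI : ∀ w, HasDerivAt I ((h w - N) * e w) w := by
    intro w
    have hcont : Continuous fun x => (h x - N) * e x := (hc.sub continuous_const).mul hec
    have h2 : I = fun w => I 0 + ∫ x in (0 : ℝ)..w, (h x - N) * e x := by
      ext w
      rw [← intervalIntegral.integral_Iic_sub_Iic hri.integrableOn hri.integrableOn]
      simp only [I]
      ring
    rw [h2]
    exact (hcont.integral_hasStrictDerivAt 0 w).hasDerivAt.const_add _
  have hI0 : ∀ w, 0 ≤ I w := by
    intro w
    have := integral_Iic_nonpos_of_monotone (r := fun x => -(h x - N)) (e := e)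
      (fun x y hxy => by have := hanti hxy; simp only; linarith) (fun x => (he x).le)
      (by simp_rw [neg_mul]; exact hri.neg) (by simp_rw [neg_mul, integral_neg, hr0, neg_zero]) w
    simp_rw [neg_mul, integral_neg] at this
    simp only [I]
    linarith
  -- The function `h - N + L x` is monotone with Gaussian mean zero, so its integral up to `w` is
  -- nonpositive; the linear part contributes `-L e w`.
  have hIL : ∀ w, I w ≤ L * e w := by
    intro w
    have hsum : ∀ x, (h x - N + L * x) * e x = (h x - N) * e x + L * (x * e x) := fun x => by ring
    have := integral_Iic_nonpos_of_monotone (r := fun x => h x - N + L * x) (e := e)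
      (fun x y hxy => by have := hmono hxy; simp only at this ⊢; linarith) (fun x => (he x).le)
      (by simp_rw [hsum]; exact hri.add (hxe.const_mul L))
      (by
        simp_rw [hsum]
        rw [integral_add hri (hxe.const_mul L), integral_const_mul, hr0, hxe0]
        simp) w
    simp_rw [hsum] at this
    rw [integral_add hri.integrableOn (hxe.const_mul L).integrableOn, integral_const_mul,
      integral_Iic_mul_exp_neg_sq_half] at this
    simp only [I, e] at this ⊢
    linarith
  let f : ℝ → ℝ := fun w => I w / e w
  have hf0 : ∀ w, 0 ≤ f w := fun w => div_nonneg (hI0 w) (he w).le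
  have hfL : ∀ w, f w ≤ L := fun w => (div_le_iff₀ (he w)).mpr (hIL w)
  let f' : ℝ → ℝ := fun w => w * f w + (h w - N)
  have hf : ∀ w, HasDerivAt f (f' w) w := by
    intro w
    refine ((hI w).div (hasDerivAt_exp_neg_sq_half w) (he w).ne').congr_deriv ?_
    have := (he w).ne'
    change ((h w - N) * e w * e w - I w * (-w * e w)) / e w ^ 2 = w * (I w / e w) + (h w - N)
    field_simp
    ring
  have hfc : Continuous f := continuous_iff_continuousAt.mpr fun w => (hf w).continuousAt
  have hr1 : ∀ x, |h x - N| ≤ 1 := fun x =>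
    abs_le.mpr ⟨by linarith [h0 x], by linarith [h1 x]⟩
  have hxf : ∀ w, |w * f w| ≤ 1 := abs_mul_le_of_hasDerivWithinAt (M := L) hfc
    (r := fun x => h x - N) (fun x => (hf x).hasDerivWithinAt)
    (fun x => abs_le.mpr ⟨by linarith [hf0 x, hfL x], hfL x⟩) hr1
  have hf'2 : ∀ w, |f' w| ≤ 2 := fun w => by
    refine (abs_add_le _ _).trans ?_
    linarith [hxf w, hr1 w]
  have hf'c : Continuous f' := (continuous_id.mul hfc).add (hc.sub continuous_const)
  -- Differentiating Stein's equation shows that `f'` solves an equation of the same type, with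
  -- right-hand side `f + h'`.
  have hf'd : ∀ x, HasDerivWithinAt f' (x * f' x + (f x + h' x)) (Set.Ici x) x := by
    intro x
    refine (((hasDerivAt_id x).mul (hf x)).hasDerivWithinAt.add ((hd x).sub_const N)).congr_deriv ?_
    simp only [id]
    ring
  -- Since `0 ≤ f ≤ L` and `-L ≤ h' ≤ 0`, the two terms have opposite signs, so the bound is `L` and
  -- not `2 L`.
  have hr2 : ∀ x, |f x + h' x| ≤ L := fun x =>
    abs_le.mpr ⟨by linarith [hf0 x, hdL x], by linarith [hfL x, hd0 x]⟩
  have hxf' := abs_mul_le_of_hasDerivWithinAt (M := 2) hf'c (r := fun x => f x + h' x) hf'd hf'2 hr2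
  refine ⟨f, f', hf, fun x => rfl, hf'2, abs_sub_le_of_hasDerivWithinAt hf'c hf'd fun x => ?_⟩
  refine (abs_add_le _ _).trans ?_
  linarith [hxf' x, hr2 x]

/-- The error in the trapezoidal rule for a function with Lipschitz derivative. -/
theorem abs_trapezoid_error_le {f f' : ℝ → ℝ} {L : ℝ} (hf : ∀ x, HasDerivAt f (f' x) x)
    (hL : ∀ x y, |f' x - f' y| ≤ 2 * L * |x - y|) (x y : ℝ) :
    |(y - x) * (f' x + f' y) / 2 - (f y - f x)| ≤ L * (y - x) ^ 2 := by
  have key : ∀ x y, x < y →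
      |(y - x) * (f' x + f' y) / 2 - (f y - f x)| ≤ L * (y - x) ^ 2 := by
    intro x y hxy
    -- At a mean value point `c` the distances to `x` and `y` add up to `y - x`; averaging the two
    -- Lipschitz bounds gives the constant `L`.
    obtain ⟨c, hc, hc'⟩ := exists_hasDerivAt_eq_slope f f' hxy
      (fun x _ => (hf x).continuousAt.continuousWithinAt) (fun x _ => hf x)
    have hpos : 0 < y - x := sub_pos.mpr hxy
    rw [eq_div_iff hpos.ne'] at hc'
    rw [← hc', show (y - x) * (f' x + f' y) / 2 - f' c * (y - x)
      = (y - x) * (((f' x - f' c) + (f' y - f' c)) / 2) by ring, abs_mul, abs_of_pos hpos]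
    have h1 := hL x c
    have h2 := hL y c
    rw [abs_of_neg (sub_neg.mpr hc.1)] at h1
    rw [abs_of_pos (sub_pos.mpr hc.2)] at h2
    have h3 : |((f' x - f' c) + (f' y - f' c)) / 2| ≤ L * (y - x) := by
      rw [abs_div, abs_two]
      have := abs_add_le (f' x - f' c) (f' y - f' c)
      linarith
    calc _ ≤ (y - x) * (L * (y - x)) := mul_le_mul_of_nonneg_left h3 hpos.le
      _ = _ := by ring
  rcases lt_trichotomy x y with h | rfl | h
  · exact key x y h
  · simp
  · have := key y x h
    rw [← abs_neg] at this
    convert this using 1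
    · congr 1; ring
    · ring

/-! ### Piecewise linear cutoffs and their Gaussian means. -/

/-- The continuous function equal to `1` before `z`, to `0` after `z + δ`, and linear between. -/
noncomputable def linearCutoff (z δ x : ℝ) : ℝ := max 0 (min 1 ((z + δ - x) / δ))

theorem linearCutoff_nonneg (z δ x : ℝ) : 0 ≤ linearCutoff z δ x := le_max_left _ _

theorem linearCutoff_le_one (z δ x : ℝ) : linearCutoff z δ x ≤ 1 :=
  max_le zero_le_one (min_le_left _ _)

theorem continuous_linearCutoff (z δ : ℝ) : Continuous (linearCutoff z δ) := by
  unfold linearCutoff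
  fun_prop

theorem linearCutoff_of_le {z δ x : ℝ} (hδ : 0 < δ) (h : x ≤ z) : linearCutoff z δ x = 1 := by
  have : 1 ≤ (z + δ - x) / δ := by rw [le_div_iff₀ hδ]; linarith
  simp [linearCutoff, min_eq_left this]

theorem linearCutoff_of_ge {z δ x : ℝ} (hδ : 0 < δ) (h : z + δ ≤ x) : linearCutoff z δ x = 0 := by
  have : (z + δ - x) / δ ≤ 0 := div_nonpos_of_nonpos_of_nonneg (by linarith) hδ.le
  rw [linearCutoff, max_eq_left ((min_le_right _ _).trans this)]

theorem linearCutoff_of_mem {z δ x : ℝ} (hδ : 0 < δ) (h1 : z ≤ x) (h2 : x ≤ z + δ) :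
    linearCutoff z δ x = (z + δ - x) / δ := by
  have h3 : (z + δ - x) / δ ≤ 1 := by rw [div_le_one hδ]; linarith
  have h4 : 0 ≤ (z + δ - x) / δ := div_nonneg (by linarith) hδ.le
  rw [linearCutoff, min_eq_right h3, max_eq_right h4]

theorem antitone_linearCutoff {z δ : ℝ} (hδ : 0 < δ) : Antitone (linearCutoff z δ) := by
  intro x y hxy
  unfold linearCutoff
  gcongr

theorem monotone_linearCutoff_add {z δ : ℝ} (hδ : 0 < δ) :
    Monotone fun x => linearCutoff z δ x + 1 / δ * x := by
  have h : (fun x => linearCutoff z δ x + 1 / δ * x)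
      = fun x => max (1 / δ * x) (min (1 + 1 / δ * x) ((z + δ) / δ)) := by
    ext x
    rw [linearCutoff, max_add, min_add]
    congr 1
    · ring
    · congr 1
      field_simp
      ring
  rw [h]
  intro x y hxy
  have : 1 / δ * x ≤ 1 / δ * y := by gcongr
  dsimp only
  gcongr

/-- At a corner the slope to the right counts, hence the half-open interval. -/
theorem hasDerivWithinAt_linearCutoff {z δ : ℝ} (hδ : 0 < δ) (x : ℝ) :
    HasDerivWithinAt (linearCutoff z δ) (if z ≤ x ∧ x < z + δ then -(1 / δ) else 0)
      (Set.Ici x) x := by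
  split_ifs with h
  · have h1 : HasDerivWithinAt (fun x => (z + δ - x) / δ) (-(1 / δ)) (Set.Ici x) x := by
      refine (((hasDerivAt_id x).const_sub (z + δ)).div_const δ).hasDerivWithinAt.congr_deriv ?_
      ring
    refine h1.congr_of_eventuallyEq ?_ (linearCutoff_of_mem hδ h.1 h.2.le)
    filter_upwards [self_mem_nhdsWithin, mem_nhdsWithin_of_mem_nhds (Iio_mem_nhds h.2)] with y hy hy'
    exact linearCutoff_of_mem hδ (h.1.trans hy) (le_of_lt hy')
  · rcases lt_or_ge x z with hx | hx
    · refine (hasDerivWithinAt_const x _ 1).congr_of_eventuallyEq ?_ (linearCutoff_of_le hδ hx.le)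
      filter_upwards [mem_nhdsWithin_of_mem_nhds (Iio_mem_nhds hx)] with y hy
      exact linearCutoff_of_le hδ (le_of_lt hy)
    · have hx' : z + δ ≤ x := not_lt.mp fun hlt => h ⟨hx, hlt⟩
      refine (hasDerivWithinAt_const x _ 0).congr_of_eventuallyEq ?_ (linearCutoff_of_ge hδ hx')
      filter_upwards [self_mem_nhdsWithin] with y hy
      exact linearCutoff_of_ge hδ (hx'.trans hy)

theorem integrable_linearCutoff_mul (z δ : ℝ) :
    Integrable fun x => linearCutoff z δ x * Real.exp (-x ^ 2 / 2) := by
  refine integrable_exp_neg_sq_half.mono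
    ((continuous_linearCutoff z δ).mul continuous_exp_neg_sq_half).aestronglyMeasurable
    (Filter.Eventually.of_forall fun x => ?_)
  rw [norm_mul, Real.norm_of_nonneg (linearCutoff_nonneg z δ x)]
  exact mul_le_of_le_one_left (norm_nonneg _) (linearCutoff_le_one z δ x)

theorem exp_neg_sq_half_le_one (x : ℝ) : Real.exp (-x ^ 2 / 2) ≤ 1 :=
  Real.exp_le_one_iff.mpr (by nlinarith [sq_nonneg x])

/-- Beyond `z` the cutoff encloses a triangle of area `δ / 2`, and the weight is at most one.
Bounding by the triangle, not the whole strip, saves a factor of two. -/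
theorem gaussianMean_linearCutoff_le {z δ : ℝ} (hδ : 0 < δ) :
    gaussianMean (linearCutoff z δ)
      ≤ 1 / √(2 * Real.pi) * (∫ x in Set.Iic z, Real.exp (-x ^ 2 / 2))
        + δ / (2 * √(2 * Real.pi)) := by
  have hpi : 0 < √(2 * Real.pi) := Real.sqrt_pos.mpr (by positivity)
  have hcont : Continuous fun x : ℝ => (z + δ - x) / δ := by fun_prop
  have h1 : ∫ x, linearCutoff z δ x * Real.exp (-x ^ 2 / 2)
      ≤ ∫ x, ((Set.Iic z).indicator (fun x => Real.exp (-x ^ 2 / 2)) x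
        + (Set.Ioc z (z + δ)).indicator (fun x => (z + δ - x) / δ) x) := by
    refine integral_mono (integrable_linearCutoff_mul z δ)
      ((integrable_exp_neg_sq_half.indicator measurableSet_Iic).add
        ((hcont.integrableOn_Ioc).integrable_indicator measurableSet_Ioc)) fun x => ?_
    simp only [Set.indicator, Set.mem_Iic, Set.mem_Ioc]
    rcases le_or_gt x z with hx | hx
    · simp [linearCutoff_of_le hδ hx, hx, not_lt.mpr hx]
    · rcases le_or_gt x (z + δ) with hx' | hx'
      · rw [linearCutoff_of_mem hδ hx.le hx']
        simp only [not_le.mpr hx, hx, hx', and_self, if_true, if_false, zero_add]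
        exact mul_le_of_le_one_right (div_nonneg (by linarith) hδ.le) (exp_neg_sq_half_le_one x)
      · simp [linearCutoff_of_ge hδ hx'.le, not_le.mpr hx, not_le.mpr hx']
  rw [integral_add (integrable_exp_neg_sq_half.indicator measurableSet_Iic)
    ((hcont.integrableOn_Ioc).integrable_indicator measurableSet_Ioc),
    integral_indicator measurableSet_Iic, integral_indicator measurableSet_Ioc,
    ← intervalIntegral.integral_of_le (by linarith), intervalIntegral.integral_div,
    intervalIntegral.integral_sub (by simp) (by simp)] at h1
  have h2 : ((∫ _ in z..(z + δ), (z + δ)) - ∫ x in z..(z + δ), x) / δ = δ / 2 := by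
    simp
    field_simp
    ring
  rw [h2] at h1
  rw [gaussianMean]
  calc _ ≤ 1 / √(2 * Real.pi) * ((∫ x in Set.Iic z, Real.exp (-x ^ 2 / 2)) + δ / 2) := by gcongr
    _ = _ := by field_simp

theorem le_gaussianMean_linearCutoff {z δ : ℝ} (hδ : 0 < δ) :
    1 / √(2 * Real.pi) * (∫ x in Set.Iic (z + δ), Real.exp (-x ^ 2 / 2))
      ≤ gaussianMean (linearCutoff z δ) + δ / (2 * √(2 * Real.pi)) := by
  have hpi : 0 < √(2 * Real.pi) := Real.sqrt_pos.mpr (by positivity)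
  have hcont : Continuous fun x : ℝ => (x - z) / δ := by fun_prop
  have h1 : ∫ x, (Set.Iic (z + δ)).indicator (fun x => Real.exp (-x ^ 2 / 2)) x
      ≤ ∫ x, (linearCutoff z δ x * Real.exp (-x ^ 2 / 2)
        + (Set.Ioc z (z + δ)).indicator (fun x => (x - z) / δ) x) := by
    refine integral_mono (integrable_exp_neg_sq_half.indicator measurableSet_Iic)
      ((integrable_linearCutoff_mul z δ).add
        ((hcont.integrableOn_Ioc).integrable_indicator measurableSet_Ioc)) fun x => ?_
    simp only [Set.indicator, Set.mem_Iic, Set.mem_Ioc]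
    rcases le_or_gt x z with hx | hx
    · simp [linearCutoff_of_le hδ hx, not_lt.mpr hx, show x ≤ z + δ by linarith]
    · rcases le_or_gt x (z + δ) with hx' | hx'
      · rw [linearCutoff_of_mem hδ hx.le hx']
        simp only [hx, hx', and_self, if_true]
        have h3 : Real.exp (-x ^ 2 / 2) = (z + δ - x) / δ * Real.exp (-x ^ 2 / 2)
            + (x - z) / δ * Real.exp (-x ^ 2 / 2) := by
          field_simp
          ring
        have h4 := mul_le_of_le_one_right (div_nonneg (sub_nonneg.mpr hx.le) hδ.le)
          (exp_neg_sq_half_le_one x)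
        linarith
      · simp [linearCutoff_of_ge hδ hx'.le, not_le.mpr hx']
  rw [integral_add (integrable_linearCutoff_mul z δ)
    ((hcont.integrableOn_Ioc).integrable_indicator measurableSet_Ioc),
    integral_indicator measurableSet_Iic, integral_indicator measurableSet_Ioc,
    ← intervalIntegral.integral_of_le (by linarith), intervalIntegral.integral_div,
    intervalIntegral.integral_sub (by simp) (by simp)] at h1
  have h2 : ((∫ x in z..(z + δ), x) - ∫ _ in z..(z + δ), z) / δ = δ / 2 := by
    simp
    field_simp
    ring
  rw [h2] at h1
  rw [gaussianMean]
  calc _ ≤ 1 / √(2 * Real.pi)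
        * ((∫ x, linearCutoff z δ x * Real.exp (-x ^ 2 / 2)) + δ / 2) := by gcongr
    _ = _ := by field_simp

/-- Cauchy-Schwarz for weighted finite sums. -/
theorem sum_weight_mul_mul_le_sqrt {ι : Type*} (s : Finset ι) (p f g : ι → ℝ)
    (hp : ∀ i, 0 ≤ p i) :
    ∑ i ∈ s, p i * (f i * g i) ≤ √((∑ i ∈ s, p i * f i ^ 2) * ∑ i ∈ s, p i * g i ^ 2) := by
  refine Real.le_sqrt_of_sq_le ?_
  have h := Finset.sum_mul_sq_le_sq_mul_sq s (fun i => √(p i) * f i) (fun i => √(p i) * g i)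
  have h1 : ∀ i, √(p i) * f i * (√(p i) * g i) = p i * (f i * g i) := fun i => by
    rw [show √(p i) * f i * (√(p i) * g i) = (√(p i) * √(p i)) * (f i * g i) by ring,
      Real.mul_self_sqrt (hp i)]
  simp only [mul_pow, Real.sq_sqrt (hp _), h1] at h
  exact h

/-! ### Stein's theorem for a finite exchangeable pair. -/

section ExchangeablePair

variable {Ω : Type*} [Fintype Ω]

theorem sum_sum_symm {P : Ω → Ω → ℝ} (hsymm : ∀ x y, P x y = P y x) (F : Ω → Ω → ℝ) :
    ∑ x, ∑ y, P x y * F x y = ∑ x, ∑ y, P x y * F y x := by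
  rw [Finset.sum_comm]
  simp_rw [fun x y => hsymm y x]

/-- Stein's identity for an exchangeable pair and a smooth test function. -/
theorem abs_sum_sub_gaussianMean_le {P : Ω → Ω → ℝ} {p W D : Ω → ℝ} {a L : ℝ} {h h' : ℝ → ℝ}
    (hP : ∀ x y, 0 ≤ P x y) (hsymm : ∀ x y, P x y = P y x) (hp : ∀ x, ∑ y, P x y = p x)
    (hp1 : ∑ x, p x = 1) (ha : 0 < a) (hW : ∀ x, ∑ y, P x y * (W y - W x) = p x * (-a * W x))
    (hD : ∀ x, ∑ y, P x y * (W y - W x) ^ 2 = p x * D x)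
    (hc : Continuous h) (h0 : ∀ x, 0 ≤ h x)
    (h1 : ∀ x, h x ≤ 1) (hanti : Antitone h) (hmono : Monotone fun x => h x + L * x)
    (hd : ∀ x, HasDerivWithinAt h (h' x) (Set.Ici x) x) (hd0 : ∀ x, h' x ≤ 0)
    (hdL : ∀ x, -L ≤ h' x) :
    |∑ x, p x * h (W x) - gaussianMean h|
      ≤ 2 * √(∑ x, p x * (1 - D x / (2 * a)) ^ 2)
        + L / (2 * a) * ∑ x, ∑ y, P x y * |W y - W x| ^ 3 := by
  obtain ⟨f, f', hf, hfeq, hf2, hfL⟩ := exists_stein_solution hc h0 h1 hanti hmono hd hd0 hdL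
  have hp0 : ∀ x, 0 ≤ p x := fun x => by
    rw [← hp x]; exact Finset.sum_nonneg fun y _ => hP x y
  have e1 : ∑ x, p x * h (W x) - gaussianMean h
      = ∑ x, p x * f' (W x) - ∑ x, p x * (W x * f (W x)) := by
    rw [← one_mul (gaussianMean h), ← hp1, Finset.sum_mul, ← Finset.sum_sub_distrib,
      ← Finset.sum_sub_distrib]
    refine Finset.sum_congr rfl fun x _ => ?_
    rw [hfeq]
    ring
  have e2 : a * ∑ x, p x * (W x * f (W x)) = -∑ x, ∑ y, P x y * ((W y - W x) * f (W x)) := by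
    rw [Finset.mul_sum, ← Finset.sum_neg_distrib]
    refine Finset.sum_congr rfl fun x _ => ?_
    simp_rw [← mul_assoc]
    rw [← Finset.sum_mul, hW]
    ring
  -- By exchangeability `(W y - W x) f(W y)` and `(W y - W x) f(W x)` have opposite means.
  have e3 : ∑ x, ∑ y, P x y * ((W y - W x) * (f (W y) - f (W x)))
      = -2 * ∑ x, ∑ y, P x y * ((W y - W x) * f (W x)) := by
    have h3 := sum_sum_symm hsymm fun x y => (W y - W x) * f (W x)
    have h4 : ∀ x y, P x y * ((W y - W x) * (f (W y) - f (W x)))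
        = -(P x y * ((W x - W y) * f (W y))) - P x y * ((W y - W x) * f (W x)) :=
      fun x y => by ring
    simp_rw [h4, Finset.sum_sub_distrib, Finset.sum_neg_distrib]
    rw [← h3]
    ring
  have e4 : ∑ x, p x * (D x * f' (W x))
      = ∑ x, ∑ y, P x y * ((W y - W x) * ((W y - W x) * (f' (W x) + f' (W y)) / 2)) := by
    have h3 := sum_sum_symm hsymm fun x y => (W y - W x) ^ 2 * f' (W x)
    have h4 : ∀ x y, P x y * ((W y - W x) * ((W y - W x) * (f' (W x) + f' (W y)) / 2))
        = 2⁻¹ * (P x y * ((W y - W x) ^ 2 * f' (W x)))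
          + 2⁻¹ * (P x y * ((W x - W y) ^ 2 * f' (W y))) :=
      fun x y => by ring
    simp_rw [h4, Finset.sum_add_distrib, ← Finset.mul_sum]
    rw [← h3]
    have h5 : ∑ x, ∑ y, P x y * ((W y - W x) ^ 2 * f' (W x)) = ∑ x, p x * (D x * f' (W x)) := by
      refine Finset.sum_congr rfl fun x _ => ?_
      simp_rw [← mul_assoc]
      rw [← Finset.sum_mul, hD]
    rw [h5]
    ring
  -- By `e2` and `e3`, `E[W f(W)] = E[Δ (f(W y) - f(W x))] / (2a)`. Replacing the increment of `f`
  -- by the trapezoidal rule produces `D f' / (2a)`, by `e4`, and leaves a cubic error.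
  have e5 : ∑ x, p x * h (W x) - gaussianMean h
      = ∑ x, p x * ((1 - D x / (2 * a)) * f' (W x))
        + 1 / (2 * a) * ∑ x, ∑ y, P x y * ((W y - W x)
          * ((W y - W x) * (f' (W x) + f' (W y)) / 2 - (f (W y) - f (W x)))) := by
    have h3 : ∀ x, p x * ((1 - D x / (2 * a)) * f' (W x))
        = p x * f' (W x) - 1 / (2 * a) * (p x * (D x * f' (W x))) := fun x => by
      field_simp
    have h4 : ∀ x y, P x y * ((W y - W x)
          * ((W y - W x) * (f' (W x) + f' (W y)) / 2 - (f (W y) - f (W x))))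
        = P x y * ((W y - W x) * ((W y - W x) * (f' (W x) + f' (W y)) / 2))
          - P x y * ((W y - W x) * (f (W y) - f (W x))) := fun x y => by ring
    simp_rw [h3, h4, Finset.sum_sub_distrib, ← Finset.mul_sum]
    rw [← e4, e1, e3, ← mul_right_inj' ha.ne', mul_sub, e2]
    generalize ∑ x, p x * f' (W x) = t₁
    generalize ∑ x, p x * (D x * f' (W x)) = t₂
    generalize ∑ x, ∑ y, P x y * ((W y - W x) * f (W x)) = t₃
    field_simp
    ring
  rw [e5]
  refine (abs_add_le _ _).trans (add_le_add ?_ ?_)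
  · calc |∑ x, p x * ((1 - D x / (2 * a)) * f' (W x))|
        ≤ ∑ x, p x * (|1 - D x / (2 * a)| * 2) := by
          refine (Finset.abs_sum_le_sum_abs _ _).trans (Finset.sum_le_sum fun x _ => ?_)
          rw [abs_mul, abs_mul, abs_of_nonneg (hp0 x)]
          gcongr
          · exact hp0 x
          · exact hf2 _
      _ = 2 * ∑ x, p x * (|1 - D x / (2 * a)| * 1) := by
          rw [Finset.mul_sum]
          exact Finset.sum_congr rfl fun x _ => by ring
      _ ≤ _ := by
          gcongr
          refine (sum_weight_mul_mul_le_sqrt _ _ _ _ hp0).trans (le_of_eq ?_)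
          simp [hp1]
  · rw [abs_mul, abs_of_pos (by positivity), div_mul_eq_mul_div, div_mul_eq_mul_div, one_mul]
    gcongr
    rw [Finset.mul_sum]
    refine (Finset.abs_sum_le_sum_abs _ _).trans (Finset.sum_le_sum fun x _ => ?_)
    rw [Finset.mul_sum]
    refine (Finset.abs_sum_le_sum_abs _ _).trans (Finset.sum_le_sum fun y _ => ?_)
    rw [abs_mul, abs_of_nonneg (hP x y), abs_mul]
    calc _ ≤ P x y * (|W y - W x| * (L * (W y - W x) ^ 2)) := by
          gcongr
          · exact hP x y
          · exact abs_trapezoid_error_le hf hfL _ _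
      _ = _ := by rw [← sq_abs]; ring

/-- Stein's normal approximation theorem for a finite exchangeable pair. -/
theorem stein_exchangeable_pair {P : Ω → Ω → ℝ} {p W D : Ω → ℝ} {a : ℝ}
    (hP : ∀ x y, 0 ≤ P x y) (hsymm : ∀ x y, P x y = P y x) (hp : ∀ x, ∑ y, P x y = p x)
    (hp1 : ∑ x, p x = 1) (ha : 0 < a) (hW : ∀ x, ∑ y, P x y * (W y - W x) = p x * (-a * W x))
    (hD : ∀ x, ∑ y, P x y * (W y - W x) ^ 2 = p x * D x) (x₀ : ℝ) :
    |∑ x, p x * (if W x < x₀ then 1 else 0)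
        - 1 / √(2 * Real.pi) * ∫ x in Set.Iic x₀, Real.exp (-x ^ 2 / 2)|
      ≤ 2 * √(∑ x, p x * (1 - D x / (2 * a)) ^ 2)
        + √((∑ x, ∑ y, P x y * |W y - W x| ^ 3) / a) / √√(2 * Real.pi) := by
  set B := ∑ x, ∑ y, P x y * |W y - W x| ^ 3 with hB
  set A := √(∑ x, p x * (1 - D x / (2 * a)) ^ 2)
  set s := √(2 * Real.pi) with hs
  have hs0 : 0 < s := Real.sqrt_pos.mpr (by positivity)
  have hp0 : ∀ x, 0 ≤ p x := fun x => by
    rw [← hp x]; exact Finset.sum_nonneg fun y _ => hP x y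
  have hB0 : 0 ≤ B := Finset.sum_nonneg fun x _ => Finset.sum_nonneg fun y _ =>
    mul_nonneg (hP x y) (by positivity)
  have hcut : ∀ z δ : ℝ, 0 < δ → |∑ x, p x * linearCutoff z δ (W x)
      - gaussianMean (linearCutoff z δ)| ≤ 2 * A + 1 / δ / (2 * a) * B := by
    intro z δ hδ
    have hδ' : 0 < 1 / δ := by positivity
    refine abs_sum_sub_gaussianMean_le hP hsymm hp hp1 ha hW hD (continuous_linearCutoff z δ)
      (linearCutoff_nonneg z δ) (linearCutoff_le_one z δ) (antitone_linearCutoff hδ)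
      (monotone_linearCutoff_add hδ) (hasDerivWithinAt_linearCutoff hδ) (fun x => ?_) (fun x => ?_)
    · split_ifs <;> linarith
    · split_ifs <;> linarith
  have hmain : ∀ δ : ℝ, 0 < δ → |∑ x, p x * (if W x < x₀ then 1 else 0)
        - 1 / s * ∫ x in Set.Iic x₀, Real.exp (-x ^ 2 / 2)|
      ≤ 2 * A + (δ / (2 * s) + 1 / δ / (2 * a) * B) := by
    intro δ hδ
    -- The indicator lies between the cutoffs that start at `x₀ - δ` and at `x₀`.
    have hu : ∑ x, p x * (if W x < x₀ then 1 else 0) ≤ ∑ x, p x * linearCutoff x₀ δ (W x) := by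
      refine Finset.sum_le_sum fun x _ => mul_le_mul_of_nonneg_left ?_ (hp0 x)
      split_ifs with h
      · rw [linearCutoff_of_le hδ h.le]
      · exact linearCutoff_nonneg _ _ _
    have hl : ∑ x, p x * linearCutoff (x₀ - δ) δ (W x) ≤ ∑ x, p x * (if W x < x₀ then 1 else 0) := by
      refine Finset.sum_le_sum fun x _ => mul_le_mul_of_nonneg_left ?_ (hp0 x)
      split_ifs with h
      · exact linearCutoff_le_one _ _ _
      · rw [linearCutoff_of_ge hδ (by linarith [not_lt.mp h])]
    have h1 := abs_le.mp (hcut x₀ δ hδ)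
    have h2 := abs_le.mp (hcut (x₀ - δ) δ hδ)
    have h3 := gaussianMean_linearCutoff_le (z := x₀) hδ
    have h4 := le_gaussianMean_linearCutoff (z := x₀ - δ) hδ
    rw [sub_add_cancel] at h4
    rw [← hs] at h3 h4
    rw [abs_le]
    constructor <;> linarith [h1.1, h1.2, h2.1, h2.2]
  -- For `B = 0` the infimum over `δ` is only approached as `δ → 0`; otherwise `δ = t v` makes the
  -- two `δ`-dependent terms equal, which minimizes their sum.
  rcases hB0.eq_or_lt with hB' | hB'
  · rw [← hB']
    simp only [zero_div, Real.sqrt_zero, add_zero]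
    refine le_of_forall_pos_le_add fun ε hε => ?_
    have := hmain (2 * s * ε) (by positivity)
    rw [← hB'] at this
    refine this.trans (le_of_eq ?_)
    field_simp
    ring
  · set t := √(B / a)
    set v := √s
    have ht : 0 < t := Real.sqrt_pos.mpr (by positivity)
    have hv : 0 < v := Real.sqrt_pos.mpr hs0
    have ht2 : B = a * t ^ 2 := by
      rw [Real.sq_sqrt (by positivity)]
      field_simp
    have hv2 : s = v ^ 2 := (Real.sq_sqrt hs0.le).symm
    refine (hmain (t * v) (by positivity)).trans (le_of_eq ?_)
    rw [ht2, hv2]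
    field_simp
    ring

end ExchangeablePair

/-! ### The exchangeable pair on tuples. -/

section HammingPair

variable (n q : ℕ) (X₀ : Fin n → Fin q) (b : Fin (n + 1) → ℝ)

/-- The joint law of the exchangeable pair on tuples: a uniform tuple `x` and a tuple `y` at
random distance `T` from `x`. -/
noncomputable def hammingPair (x y : Fin n → Fin q) : ℝ :=
  1 / (q : ℝ) ^ n * ∑ t : Fin (n + 1),
    b t / hammingValency n q t * (if hammingDist x y = t then 1 else 0)

/-- The eigenvalue `∑ b_t K_j(t) / v_j` of the transition operator of the pair. -/
noncomputable def hammingEigenvalue (j : ℕ) : ℝ :=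
  (∑ t : Fin (n + 1), b t * krawtchouk n q j t) / hammingValency n q j

theorem hammingPair_symm (x y : Fin n → Fin q) :
    hammingPair n q b x y = hammingPair n q b y x := by
  simp_rw [hammingPair, hammingDist_comm x y]

variable {n q b}

theorem hammingPair_nonneg (hq : 2 ≤ q) (hb : ∀ t, 0 ≤ b t) (x y : Fin n → Fin q) :
    0 ≤ hammingPair n q b x y := by
  refine mul_nonneg (by positivity) (Finset.sum_nonneg fun t _ => mul_nonneg ?_ ?_)
  · exact div_nonneg (hb t) (hammingValency_pos n q t hq (Nat.lt_succ_iff.mp t.2)).le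
  · split_ifs <;> norm_num

theorem hammingValency_zero : hammingValency n q 0 = 1 := by simp [hammingValency]

theorem hammingEigenvalue_zero (hb : ∑ t, b t = 1) : hammingEigenvalue n q b 0 = 1 := by
  simp [hammingEigenvalue, krawtchouk_zero_left, hammingValency_zero, hb]

/-- Averaging over the sphere of radius `t` multiplies by `K_t(j) / v_t`, which `krawtchouk_symm`
turns into `K_j(t) / v_j`. -/
theorem sum_hammingPair_krawtchouk (hq : 2 ≤ q) {j : ℕ} (hj : j ≤ n) (x : Fin n → Fin q) :
    ∑ y, hammingPair n q b x y * krawtchouk n q j (hammingDist X₀ y)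
      = 1 / (q : ℝ) ^ n * (hammingEigenvalue n q b j * krawtchouk n q j (hammingDist X₀ x)) := by
  have h1 : ∀ y, hammingPair n q b x y * krawtchouk n q j (hammingDist X₀ y)
      = 1 / (q : ℝ) ^ n * ∑ t : Fin (n + 1), b t / hammingValency n q t *
        (if hammingDist x y = t then krawtchouk n q j (hammingDist X₀ y) else 0) := by
    intro y
    rw [hammingPair, mul_assoc, Finset.sum_mul]
    congr 1
    refine Finset.sum_congr rfl fun t _ => ?_
    split_ifs <;> ring
  simp_rw [h1, ← Finset.mul_sum]
  rw [Finset.sum_comm]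
  simp_rw [← Finset.mul_sum, sum_krawtchouk_hammingDist, hammingEigenvalue]
  rw [Finset.sum_div, Finset.sum_mul]
  congr 1
  refine Finset.sum_congr rfl fun t _ => ?_
  have h2 := (hammingValency_pos n q t hq (Nat.lt_succ_iff.mp t.2)).ne'
  have h3 := (hammingValency_pos n q j hq hj).ne'
  have h4 := krawtchouk_symm n q j t X₀
  field_simp
  linear_combination b t * krawtchouk n q j (hammingDist X₀ x) * h4

theorem sum_hammingPair (hq : 2 ≤ q) (hb : ∑ t, b t = 1) (x : Fin n → Fin q) :
    ∑ y, hammingPair n q b x y = 1 / (q : ℝ) ^ n := by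
  have h := sum_hammingPair_krawtchouk (b := b) x hq (Nat.zero_le n) x
  simpa [krawtchouk_zero_left, hammingEigenvalue_zero hb] using h

theorem sum_uniform (hq : 2 ≤ q) : ∑ _x : Fin n → Fin q, 1 / (q : ℝ) ^ n = 1 := by
  have : (q : ℝ) ≠ 0 := by positivity
  simp [this]

/-- Parseval's identity for Krawtchouk expansions. -/
theorem sum_krawtchouk_expansion_mul (hq : 2 ≤ q) (s : Finset ℕ) (c d : ℕ → ℝ) :
    ∑ x : Fin n → Fin q, 1 / (q : ℝ) ^ n *
        ((∑ j ∈ s, c j * krawtchouk n q j (hammingDist X₀ x))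
          * ∑ j ∈ s, d j * krawtchouk n q j (hammingDist X₀ x))
      = ∑ j ∈ s, c j * d j * hammingValency n q j := by
  have hq0 : (q : ℝ) ≠ 0 := by positivity
  rw [← Finset.mul_sum]
  simp_rw [Finset.sum_mul_sum]
  rw [Finset.sum_comm, Finset.mul_sum]
  refine Finset.sum_congr rfl fun i hi => ?_
  rw [Finset.sum_comm]
  simp_rw [mul_mul_mul_comm, ← Finset.mul_sum, sum_krawtchouk_mul_krawtchouk]
  simp only [mul_ite, mul_zero, Finset.sum_ite_eq, hi, if_true]
  field_simp

theorem sum_hammingPair_expansion (hq : 2 ≤ q) (c : ℕ → ℝ) (x : Fin n → Fin q) :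
    ∑ y, hammingPair n q b x y *
        ∑ j ∈ Finset.range (n + 1), c j * krawtchouk n q j (hammingDist X₀ y)
      = 1 / (q : ℝ) ^ n * ∑ j ∈ Finset.range (n + 1),
          c j * hammingEigenvalue n q b j * krawtchouk n q j (hammingDist X₀ x) := by
  simp_rw [Finset.mul_sum]
  rw [Finset.sum_comm]
  refine Finset.sum_congr rfl fun j hj => ?_
  have h := sum_hammingPair_krawtchouk (b := b) X₀ hq (Nat.lt_succ_iff.mp (Finset.mem_range.mp hj)) x
  simp_rw [mul_left_comm _ (c j), ← Finset.mul_sum, h]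
  ring

end HammingPair

/-- There are `v_i` tuples at distance `i` from `X₀`; this moves expectations between the Plancherel
measure and uniform tuples. -/
theorem sum_hammingDist (n q : ℕ) (X₀ : Fin n → Fin q) (F : ℕ → ℝ) :
    ∑ x : Fin n → Fin q, F (hammingDist X₀ x)
      = ∑ i : Fin (n + 1), hammingValency n q i * F i := by
  simp_rw [← card_hammingDist_eq n q _ X₀, Finset.sum_mul]
  rw [Finset.sum_comm]
  refine Finset.sum_congr rfl fun x _ => ?_
  rw [Finset.sum_eq_single ⟨hammingDist X₀ x, Nat.lt_succ_of_le (hammingDist_le n q X₀ x)⟩]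
  · simp
  · intro i _ hi
    rw [if_neg fun h => hi (Fin.ext h.symm), zero_mul]
  · simp

open Classical in
theorem hammingPlancherel_real (n q : ℕ) (hq : 2 ≤ q) (X₀ : Fin n → Fin q)
    (s : Set ℕ) :
    (hammingPlancherel n q).real {i | (i : ℕ) ∈ s}
      = ∑ x : Fin n → Fin q, 1 / (q : ℝ) ^ n * (if hammingDist X₀ x ∈ s then 1 else 0) := by
  rw [sum_hammingDist n q X₀ fun i => 1 / (q : ℝ) ^ n * (if i ∈ s then 1 else 0)]
  simp only [Measure.real, hammingPlancherel, Measure.coe_finsetSum, Finset.sum_apply,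
    Measure.smul_apply, smul_eq_mul]
  rw [ENNReal.toReal_sum fun i _ => ENNReal.mul_ne_top ENNReal.ofReal_ne_top (measure_ne_top _ _)]
  refine Finset.sum_congr rfl fun i _ => ?_
  have h := (hammingValency_pos n q i hq (Nat.lt_succ_iff.mp i.2)).le
  rw [ENNReal.toReal_mul, ENNReal.toReal_ofReal (by positivity), Measure.dirac_apply]
  by_cases hi : (i : ℕ) ∈ s <;> simp [hi, div_eq_mul_inv]

/-- The variable `W` as a function on tuples. -/
noncomputable def hammingTupleW (n q : ℕ) (X₀ x : Fin n → Fin q) : ℝ :=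
  krawtchouk n q 1 (hammingDist X₀ x) / √(hammingValency n q 1)

/-! ### Moments of `W` and of its increment. -/

section HammingMoments

variable {n q : ℕ} (hn : 1 ≤ n) (hq : 2 ≤ q) (X₀ : Fin n → Fin q) {b : Fin (n + 1) → ℝ}

/-- The coefficients of the Krawtchouk expansion of `W ^ 2 / v_1`. -/
noncomputable def squareCoeff (n q : ℕ) (X₀ : Fin n → Fin q) (j : ℕ) : ℝ :=
  hammingP2 n q X₀ j / hammingValency n q j

include hn hq

theorem hammingTupleW_sq (x : Fin n → Fin q) :
    hammingTupleW n q X₀ x ^ 2 = hammingValency n q 1 * ∑ j ∈ Finset.range (n + 1),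
      squareCoeff n q X₀ j * krawtchouk n q j (hammingDist X₀ x) := by
  have hv := hammingValency_pos n q 1 hq hn
  have h := krawtchouk_one_sq n q (hammingDist X₀ x) hq (hammingDist_le n q X₀ x) X₀
  simp_rw [squareCoeff, ← h, hammingTupleW, div_pow, Real.sq_sqrt hv.le]
  field_simp

/-- This is `E[W²] = 1`: only the coefficient of `K_0 = 1` survives the expectation. -/
theorem squareCoeff_zero : hammingValency n q 1 * squareCoeff n q X₀ 0 = 1 := by
  have hv := hammingValency_pos n q 1 hq hn
  have hq0 : (q : ℝ) ≠ 0 := by positivity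
  have h1 := sum_krawtchouk_mul_krawtchouk n q 1 1 X₀
  have h2 := sum_krawtchouk_expansion_mul X₀ hq (Finset.range (n + 1)) (squareCoeff n q X₀)
    fun j => if j = 0 then 1 else 0
  have h3 : ∀ x : Fin n → Fin q, ∑ j ∈ Finset.range (n + 1),
      (if j = 0 then (1 : ℝ) else 0) * krawtchouk n q j (hammingDist X₀ x) = 1 := fun x => by
    simp [krawtchouk_zero_left]
  have h4 : ∀ x : Fin n → Fin q, krawtchouk n q 1 (hammingDist X₀ x)
      * krawtchouk n q 1 (hammingDist X₀ x) = hammingValency n q 1 ^ 2 *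
        ∑ j ∈ Finset.range (n + 1),
          squareCoeff n q X₀ j * krawtchouk n q j (hammingDist X₀ x) := fun x => by
    have h := krawtchouk_one_sq n q (hammingDist X₀ x) hq (hammingDist_le n q X₀ x) X₀
    simp_rw [squareCoeff, ← h]
    field_simp
  simp_rw [h3, mul_one, ← Finset.mul_sum] at h2
  simp_rw [h4, ← Finset.mul_sum, if_true] at h1
  simp only [mul_ite, mul_one, mul_zero, ite_mul, zero_mul, Finset.sum_ite_eq',
    Finset.mem_range, Nat.succ_pos, if_true, hammingValency_zero] at h2
  rw [← h2]
  generalize ∑ x : Fin n → Fin q, ∑ j ∈ Finset.range (n + 1),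
    squareCoeff n q X₀ j * krawtchouk n q j (hammingDist X₀ x) = S at h1
  field_simp
  have : hammingValency n q 1 * (hammingValency n q 1 * S) = hammingValency n q 1 * (q : ℝ) ^ n := by
    linarith
  exact mul_left_cancel₀ hv.ne' this

theorem sum_hammingPair_W (x : Fin n → Fin q) :
    ∑ y, hammingPair n q b x y * hammingTupleW n q X₀ y
      = 1 / (q : ℝ) ^ n * (hammingEigenvalue n q b 1 * hammingTupleW n q X₀ x) := by
  simp_rw [hammingTupleW, ← mul_div_assoc, ← Finset.sum_div]
  rw [sum_hammingPair_krawtchouk X₀ hq hn]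

theorem sum_hammingPair_W_sq (x : Fin n → Fin q) :
    ∑ y, hammingPair n q b x y * hammingTupleW n q X₀ y ^ 2
      = 1 / (q : ℝ) ^ n * (hammingValency n q 1 * ∑ j ∈ Finset.range (n + 1),
          squareCoeff n q X₀ j * hammingEigenvalue n q b j
            * krawtchouk n q j (hammingDist X₀ x)) := by
  simp_rw [hammingTupleW_sq hn hq]
  simp_rw [mul_left_comm _ (hammingValency n q 1), ← Finset.mul_sum]
  rw [sum_hammingPair_expansion X₀ hq]

/-- The conditional second moment of the increment. -/
theorem sum_hammingPair_W_sub_sq (hb : ∑ t, b t = 1) (x : Fin n → Fin q) :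
    ∑ y, hammingPair n q b x y * (hammingTupleW n q X₀ y - hammingTupleW n q X₀ x) ^ 2
      = 1 / (q : ℝ) ^ n * (hammingValency n q 1 * ∑ j ∈ Finset.range (n + 1),
          squareCoeff n q X₀ j * (hammingEigenvalue n q b j + 1 - 2 * hammingEigenvalue n q b 1)
            * krawtchouk n q j (hammingDist X₀ x)) := by
  have h1 : ∀ y, hammingPair n q b x y * (hammingTupleW n q X₀ y - hammingTupleW n q X₀ x) ^ 2
      = hammingPair n q b x y * hammingTupleW n q X₀ y ^ 2
        - 2 * hammingTupleW n q X₀ x * (hammingPair n q b x y * hammingTupleW n q X₀ y)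
        + hammingPair n q b x y * hammingTupleW n q X₀ x ^ 2 := fun y => by ring
  have h2 : ∑ j ∈ Finset.range (n + 1), squareCoeff n q X₀ j
        * (hammingEigenvalue n q b j + 1 - 2 * hammingEigenvalue n q b 1)
        * krawtchouk n q j (hammingDist X₀ x)
      = ∑ j ∈ Finset.range (n + 1), squareCoeff n q X₀ j * hammingEigenvalue n q b j
            * krawtchouk n q j (hammingDist X₀ x)
        + (1 - 2 * hammingEigenvalue n q b 1) * ∑ j ∈ Finset.range (n + 1),
            squareCoeff n q X₀ j * krawtchouk n q j (hammingDist X₀ x) := by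
    rw [Finset.mul_sum, ← Finset.sum_add_distrib]
    exact Finset.sum_congr rfl fun j _ => by ring
  simp_rw [h1, Finset.sum_add_distrib, Finset.sum_sub_distrib, ← Finset.mul_sum, ← Finset.sum_mul]
  rw [sum_hammingPair_W_sq hn hq, sum_hammingPair_W hn hq, sum_hammingPair hq hb, h2]
  linear_combination (1 / (q : ℝ) ^ n * (1 - 2 * hammingEigenvalue n q b 1))
    * hammingTupleW_sq hn hq X₀ x

/-- Taking the expectation keeps only the `K_0` term, with coefficient `v_1 c_0 (1 + 1 - 2 λ_1)`,
where `v_1 c_0 = 1`. -/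
theorem sum_sum_hammingPair_W_sub_sq (hb : ∑ t, b t = 1) :
    ∑ x, ∑ y, hammingPair n q b x y * (hammingTupleW n q X₀ y - hammingTupleW n q X₀ x) ^ 2
      = 2 * (1 - hammingEigenvalue n q b 1) := by
  simp_rw [sum_hammingPair_W_sub_sq hn hq X₀ hb, mul_left_comm _ (hammingValency n q 1)]
  rw [← Finset.mul_sum]
  have h2 := sum_krawtchouk_expansion_mul X₀ hq (Finset.range (n + 1))
    (fun j => squareCoeff n q X₀ j
      * (hammingEigenvalue n q b j + 1 - 2 * hammingEigenvalue n q b 1))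
    fun j => if j = 0 then 1 else 0
  have h3 : ∀ x : Fin n → Fin q, ∑ j ∈ Finset.range (n + 1),
      (if j = 0 then (1 : ℝ) else 0) * krawtchouk n q j (hammingDist X₀ x) = 1 := fun x => by
    simp [krawtchouk_zero_left]
  simp_rw [h3, mul_one] at h2
  rw [h2]
  simp only [mul_ite, mul_one, mul_zero, ite_mul, zero_mul, Finset.sum_ite_eq',
    Finset.mem_range, Nat.succ_pos, if_true, hammingValency_zero, hammingEigenvalue_zero hb]
  linear_combination (2 - 2 * hammingEigenvalue n q b 1) * squareCoeff_zero hn hq X₀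

theorem sum_W_pow_four :
    ∑ x : Fin n → Fin q, 1 / (q : ℝ) ^ n * hammingTupleW n q X₀ x ^ 4
      = hammingValency n q 1 ^ 2 * ∑ j ∈ Finset.range (n + 1),
          squareCoeff n q X₀ j ^ 2 * hammingValency n q j := by
  have h := sum_krawtchouk_expansion_mul X₀ hq (Finset.range (n + 1)) (squareCoeff n q X₀)
    (squareCoeff n q X₀)
  simp_rw [pow_two (squareCoeff n q X₀ _)]
  rw [← h, Finset.mul_sum]
  refine Finset.sum_congr rfl fun x _ => ?_
  rw [show hammingTupleW n q X₀ x ^ 4 = (hammingTupleW n q X₀ x ^ 2) ^ 2 by ring,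
    hammingTupleW_sq hn hq]
  ring

/-- The fourth moment of the increment. -/
theorem sum_sum_hammingPair_W_sub_pow_four (hb : ∑ t, b t = 1) :
    ∑ x, ∑ y, hammingPair n q b x y * (hammingTupleW n q X₀ y - hammingTupleW n q X₀ x) ^ 4
      = hammingValency n q 1 ^ 2 * ∑ j ∈ Finset.range (n + 1),
          (8 * (1 - hammingEigenvalue n q b 1) - 6 * (1 - hammingEigenvalue n q b j))
            * (squareCoeff n q X₀ j ^ 2 * hammingValency n q j) := by
  set P := hammingPair n q b
  set W := hammingTupleW n q X₀ with hWdef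
  -- The outer and the cubic terms are multiples of `E[W⁴]`, by symmetry and regression; the middle
  -- term is found by Parseval. Together they carry the factor `2 - 8 λ_1 + 6 λ_j`.
  have h1 : ∀ x y, P x y * (W y - W x) ^ 4
      = P x y * W x ^ 4 + P x y * W y ^ 4 - 4 * (P x y * (W x ^ 3 * W y))
        - 4 * (P x y * (W y ^ 3 * W x)) + 6 * (P x y * (W x ^ 2 * W y ^ 2)) := fun x y => by ring
  have hs1 := sum_sum_symm (hammingPair_symm n q b) fun x y => W x ^ 4
  have hs2 := sum_sum_symm (hammingPair_symm n q b) fun x y => W x ^ 3 * W y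
  have h2 : ∑ x, ∑ y, P x y * W x ^ 4 = ∑ x, 1 / (q : ℝ) ^ n * W x ^ 4 := by
    refine Finset.sum_congr rfl fun x _ => ?_
    rw [← Finset.sum_mul, sum_hammingPair hq hb]
  have h3 : ∑ x, ∑ y, P x y * (W x ^ 3 * W y)
      = hammingEigenvalue n q b 1 * ∑ x, 1 / (q : ℝ) ^ n * W x ^ 4 := by
    rw [Finset.mul_sum]
    refine Finset.sum_congr rfl fun x _ => ?_
    simp_rw [mul_left_comm _ (W x ^ 3), ← Finset.mul_sum]
    rw [sum_hammingPair_W hn hq, ← hWdef]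
    ring
  have h4 : ∑ x, ∑ y, P x y * (W x ^ 2 * W y ^ 2) = hammingValency n q 1 ^ 2 *
      ∑ j ∈ Finset.range (n + 1), squareCoeff n q X₀ j
        * (squareCoeff n q X₀ j * hammingEigenvalue n q b j) * hammingValency n q j := by
    rw [← sum_krawtchouk_expansion_mul X₀ hq, Finset.mul_sum]
    refine Finset.sum_congr rfl fun x _ => ?_
    simp_rw [mul_left_comm _ (W x ^ 2), ← Finset.mul_sum]
    rw [sum_hammingPair_W_sq hn hq, hammingTupleW_sq hn hq]
    ring
  simp_rw [h1, Finset.sum_add_distrib, Finset.sum_sub_distrib, Finset.sum_add_distrib,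
    ← Finset.mul_sum]
  rw [← hs1, ← hs2, h2, h3, h4, hWdef, sum_W_pow_four hn hq]
  have h5 : ∀ j, (8 * (1 - hammingEigenvalue n q b 1) - 6 * (1 - hammingEigenvalue n q b j))
        * (squareCoeff n q X₀ j ^ 2 * hammingValency n q j)
      = (2 - 8 * hammingEigenvalue n q b 1) * (squareCoeff n q X₀ j ^ 2 * hammingValency n q j)
        + 6 * (squareCoeff n q X₀ j
          * (squareCoeff n q X₀ j * hammingEigenvalue n q b j) * hammingValency n q j) :=
    fun j => by ring
  simp_rw [h5, Finset.sum_add_distrib, ← Finset.mul_sum]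
  ring

/-- The variance of the conditional second moment of the increment. -/
theorem sum_sq_one_sub_conditional (hb : ∑ t, b t = 1) {a : ℝ} (ha : 0 < a)
    (ha' : a = 1 - hammingEigenvalue n q b 1) :
    ∑ x : Fin n → Fin q, 1 / (q : ℝ) ^ n * (1 - hammingValency n q 1 *
        (∑ j ∈ Finset.range (n + 1), squareCoeff n q X₀ j
          * (hammingEigenvalue n q b j + 1 - 2 * hammingEigenvalue n q b 1)
          * krawtchouk n q j (hammingDist X₀ x)) / (2 * a)) ^ 2
      = (hammingValency n q 1 / (2 * a)) ^ 2 * ∑ j ∈ Finset.Icc 1 n,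
          squareCoeff n q X₀ j ^ 2 * hammingValency n q j
            * (hammingEigenvalue n q b j + 1 - 2 * hammingEigenvalue n q b 1) ^ 2 := by
  have h := sum_krawtchouk_expansion_mul X₀ hq (Finset.Icc 1 n)
    (fun j => squareCoeff n q X₀ j
      * (hammingEigenvalue n q b j + 1 - 2 * hammingEigenvalue n q b 1))
    (fun j => squareCoeff n q X₀ j
      * (hammingEigenvalue n q b j + 1 - 2 * hammingEigenvalue n q b 1))
  have h1 : ∀ j, squareCoeff n q X₀ j ^ 2 * hammingValency n q j
        * (hammingEigenvalue n q b j + 1 - 2 * hammingEigenvalue n q b 1) ^ 2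
      = squareCoeff n q X₀ j
          * (hammingEigenvalue n q b j + 1 - 2 * hammingEigenvalue n q b 1)
        * (squareCoeff n q X₀ j
          * (hammingEigenvalue n q b j + 1 - 2 * hammingEigenvalue n q b 1))
        * hammingValency n q j := fun j => by ring
  simp_rw [h1]
  rw [← h, Finset.mul_sum]
  refine Finset.sum_congr rfl fun x _ => ?_
  have h2 : Finset.range (n + 1) = insert 0 (Finset.Icc 1 n) := by
    ext j
    simp only [Finset.mem_range, Finset.mem_insert, Finset.mem_Icc]
    omega
  rw [h2, Finset.sum_insert (by simp), krawtchouk_zero_left, hammingEigenvalue_zero hb]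
  generalize ∑ j ∈ Finset.Icc 1 n, squareCoeff n q X₀ j
    * (hammingEigenvalue n q b j + 1 - 2 * hammingEigenvalue n q b 1)
    * krawtchouk n q j (hammingDist X₀ x) = S
  -- The `K_0` term equals `2a` and cancels the constant `1`, so the sum starts at `j = 1`.
  have h3 : hammingValency n q 1
      * (squareCoeff n q X₀ 0 * (1 + 1 - 2 * hammingEigenvalue n q b 1) * 1 + S)
      = 2 * a + hammingValency n q 1 * S := by
    linear_combination (2 * a) * squareCoeff_zero hn hq X₀
      - 2 * hammingValency n q 1 * squareCoeff n q X₀ 0 * ha'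
  rw [h3]
  field_simp
  ring

/-- Since `K_1(t) = v_1 - q t`, the quantity is `q E[T] / v_1`, and `T` is not almost surely zero.
-/
theorem one_sub_hammingEigenvalue_one_pos (hb_nonneg : ∀ t, 0 ≤ b t) (hb_sum : ∑ t, b t = 1)
    (hb_zero : b 0 ≠ 1) : 0 < 1 - hammingEigenvalue n q b 1 := by
  have hv := hammingValency_pos n q 1 hq hn
  have hq0 : (0 : ℝ) < q := by positivity
  have h1 : 1 - hammingEigenvalue n q b 1
      = ∑ t : Fin (n + 1), b t * (q * (t : ℕ) / hammingValency n q 1) := by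
    rw [← hb_sum, hammingEigenvalue, Finset.sum_div, ← Finset.sum_sub_distrib]
    refine Finset.sum_congr rfl fun t _ => ?_
    rw [krawtchouk_one_left n q t (Nat.lt_succ_iff.mp t.2),
      show ((q : ℝ) - 1) * n = hammingValency n q 1 by simp [hammingValency]]
    field_simp
    ring
  rw [h1]
  obtain ⟨t, ht0, ht⟩ : ∃ t, t ≠ 0 ∧ b t ≠ 0 := by
    by_contra! hcon
    apply hb_zero
    rw [← hb_sum, Finset.sum_eq_single 0 (fun t _ ht => hcon t ht) (by simp)]
  refine Finset.sum_pos' (fun t _ => mul_nonneg (hb_nonneg t) (by positivity))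
    ⟨t, Finset.mem_univ t, ?_⟩
  have hbt : 0 < b t := lt_of_le_of_ne (hb_nonneg t) ht.symm
  have htn : (0 : ℝ) < (t : ℕ) := by
    exact_mod_cast Nat.pos_of_ne_zero fun h => ht0 (Fin.ext h)
  positivity

end HammingMoments

/-! ### Assembly of the final bound. -/

theorem rpow_one_div_four {x : ℝ} (hx : 0 ≤ x) : x ^ (1 / 4 : ℝ) = √√x := by
  rw [Real.sqrt_eq_rpow, Real.sqrt_eq_rpow, ← Real.rpow_mul hx]
  norm_num

/-- The third absolute moment is bounded by the second and the fourth moments. -/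
theorem sum_sum_abs_pow_three_le {Ω : Type*} [Fintype Ω] {P : Ω → Ω → ℝ} (hP : ∀ x y, 0 ≤ P x y)
    (F : Ω → Ω → ℝ) :
    ∑ x, ∑ y, P x y * |F x y| ^ 3
      ≤ √((∑ x, ∑ y, P x y * F x y ^ 2) * ∑ x, ∑ y, P x y * F x y ^ 4) := by
  have h := sum_weight_mul_mul_le_sqrt (Finset.univ : Finset (Ω × Ω)) (fun z => P z.1 z.2)
    (fun z => |F z.1 z.2|) (fun z => |F z.1 z.2| ^ 2) fun z => hP z.1 z.2
  have h3 : ∀ x y, |F x y| * |F x y| ^ 2 = |F x y| ^ 3 := fun x y => by ring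
  have h4 : ∀ x y, (F x y ^ 2) ^ 2 = F x y ^ 4 := fun x y => by ring
  simp_rw [h3, sq_abs, h4, Fintype.sum_prod_type] at h
  exact h

theorem mainTheorem5 (n q : ℕ) (hn : 1 ≤ n) (hq : 2 ≤ q) (X₀ : Fin n → Fin q)
    (b : Fin (n + 1) → ℝ) (hb_nonneg : ∀ t, 0 ≤ b t) (hb_sum : ∑ t, b t = 1) (hb_zero : b 0 ≠ 1)
    (a : ℝ)
    (ha : a = 1 - ∑ t : Fin (n + 1), b t * (krawtchouk n q 1 t / hammingValency n q 1))
    (x₀ : ℝ) :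
    |(hammingPlancherel n q).real {i | hammingW n q i < x₀}
        - 1 / Real.sqrt (2 * Real.pi) * ∫ x in Set.Iic x₀, Real.exp (-x ^ 2 / 2)|
      ≤ hammingValency n q 1 / a *
          Real.sqrt (∑ j ∈ Finset.Icc 1 n,
            hammingP2 n q X₀ j ^ 2 / hammingValency n q j *
              ((∑ t : Fin (n + 1), b t * krawtchouk n q j t) / hammingValency n q j + 1
                - 2 * (∑ t : Fin (n + 1), b t * krawtchouk n q 1 t) / hammingValency n q 1) ^ 2)
        + Real.sqrt (hammingValency n q 1) / Real.pi ^ (1 / 4 : ℝ) *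
          (∑ j ∈ Finset.range (n + 1),
            (8 - 6 / a *
                (1 - (∑ t : Fin (n + 1), b t * krawtchouk n q j t) / hammingValency n q j)) *
              (hammingP2 n q X₀ j ^ 2 / hammingValency n q j)) ^ (1 / 4 : ℝ) := by
  have ha' : a = 1 - hammingEigenvalue n q b 1 := by
    rw [ha, hammingEigenvalue, Finset.sum_div]
    simp_rw [mul_div_assoc]
  have ha0 : 0 < a := by
    rw [ha']; exact one_sub_hammingEigenvalue_one_pos hn hq hb_nonneg hb_sum hb_zero
  have hv := hammingValency_pos n q 1 hq hn
  have hP := hammingPair_nonneg (n := n) hq hb_nonneg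
  have hcoeff : ∀ j ≤ n, hammingP2 n q X₀ j ^ 2 / hammingValency n q j
      = squareCoeff n q X₀ j ^ 2 * hammingValency n q j := fun j hj => by
    have := (hammingValency_pos n q j hq hj).ne'
    rw [squareCoeff]
    field_simp
  have hstein := stein_exchangeable_pair hP (hammingPair_symm n q b) (sum_hammingPair hq hb_sum)
    (sum_uniform hq) ha0 (W := hammingTupleW n q X₀)
    (fun x => by
      simp_rw [mul_sub, Finset.sum_sub_distrib, ← Finset.sum_mul]
      rw [sum_hammingPair_W hn hq, sum_hammingPair hq hb_sum, ha']
      ring)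
    (sum_hammingPair_W_sub_sq hn hq X₀ hb_sum) x₀
  have hlaw : (hammingPlancherel n q).real {i | hammingW n q i < x₀}
      = ∑ x, 1 / (q : ℝ) ^ n * (if hammingTupleW n q X₀ x < x₀ then 1 else 0) := by
    classical
    have := hammingPlancherel_real n q hq X₀
      {i | krawtchouk n q 1 i / √(hammingValency n q 1) < x₀}
    simp only [Set.mem_ofPred_eq] at this
    simp only [hammingW, hammingTupleW]
    rw [this]
    refine Finset.sum_congr rfl fun x _ => ?_
    congr
  rw [hlaw]
  refine hstein.trans (add_le_add (le_of_eq ?_) ?_)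
  · rw [sum_sq_one_sub_conditional hn hq X₀ hb_sum ha0 ha', Real.sqrt_mul (sq_nonneg _),
      Real.sqrt_sq (by positivity), ← mul_assoc]
    congr 1
    · field_simp
    · congr 1
      refine Finset.sum_congr rfl fun j hj => ?_
      rw [hcoeff j (Finset.mem_Icc.mp hj).2, mul_div_assoc 2]
      rfl
  · set S := ∑ j ∈ Finset.range (n + 1),
      (8 - 6 / a * (1 - (∑ t : Fin (n + 1), b t * krawtchouk n q j t) / hammingValency n q j)) *
        (hammingP2 n q X₀ j ^ 2 / hammingValency n q j) with hS
    have h4 : ∑ x, ∑ y, hammingPair n q b x y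
        * (hammingTupleW n q X₀ y - hammingTupleW n q X₀ x) ^ 4
        = hammingValency n q 1 ^ 2 * a * S := by
      rw [sum_sum_hammingPair_W_sub_pow_four hn hq X₀ hb_sum, ← ha', hS, mul_assoc,
        Finset.mul_sum _ _ a]
      congr 1
      refine Finset.sum_congr rfl fun j hj => ?_
      rw [hcoeff j (Nat.lt_succ_iff.mp (Finset.mem_range.mp hj)), hammingEigenvalue]
      field_simp
    -- Individual terms of `S` may be negative; the sum is not, being a positive multiple of a
    -- fourth moment.
    have hS0 : 0 ≤ S := by
      have h5 : 0 ≤ hammingValency n q 1 ^ 2 * a * S := by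
        rw [← h4]
        exact Finset.sum_nonneg fun x _ => Finset.sum_nonneg fun y _ =>
          mul_nonneg (hP x y) (by positivity)
      exact nonneg_of_mul_nonneg_right h5 (by positivity)
    have h3 := sum_sum_abs_pow_three_le hP
      fun x y => hammingTupleW n q X₀ y - hammingTupleW n q X₀ x
    rw [h4, sum_sum_hammingPair_W_sub_sq hn hq X₀ hb_sum, ← ha',
      show 2 * a * (hammingValency n q 1 ^ 2 * a * S)
        = (a * hammingValency n q 1) ^ 2 * (2 * S) by ring,
      Real.sqrt_mul (sq_nonneg _), Real.sqrt_sq (by positivity)] at h3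
    have h6 := (div_le_iff₀' ha0).mpr (h3.trans_eq (mul_assoc _ _ _))
    rw [rpow_one_div_four hS0, rpow_one_div_four Real.pi_pos.le]
    -- Here `E|Δ|³ / a ≤ v_1 √(2S)`; the fourth root of this `2` cancels the one in `(2π)^(1/4)`.
    calc _ ≤ √(hammingValency n q 1 * √(2 * S)) / √√(2 * Real.pi) := by gcongr
      _ = _ := by
        rw [Real.sqrt_mul hv.le, Real.sqrt_mul zero_le_two, Real.sqrt_mul zero_le_two,
          Real.sqrt_mul (Real.sqrt_nonneg _), Real.sqrt_mul (Real.sqrt_nonneg _)]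
        have : 0 < √√(2 : ℝ) := by positivity
        have : 0 < √√Real.pi := Real.sqrt_pos.mpr (Real.sqrt_pos.mpr Real.pi_pos)
        field_simp
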